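/- Let $\mathcal L$ be a meet-semilattice (a partially ordered set in which any two elements $i,j$ have a greatest lower bound $i\wedge j$), and let $\mathfrak A$ be a (not necessarily unital) $C^*$-algebra graded by $\mathcal L$: that is, we are given a family $(A_i)_{i\in\mathcal L}$ of $C^*$-subalgebras of $\mathfrak A$, called its components, which is linearly independent (the sum $\sum_i A_i$ is direct) and total (the sum $\sum_i A_i$ is dense in $\mathfrak A$) and satisfies $A_iA_j\subset A_{i\wedge j}$ for all $i,j\in\mathcal L$. A $C^*$-algebra $A$ is called nuclear if for every $C^*$-algebra $B$ the maximal and the minimal $C^*$-norm on the algebraic tensor product $A\odot B$ coincide, i.e. the natural morphism $A\otimes_{\max}B\to A\otimes_{\min}B$ is injective. Here $\|t\|_{\max}$ is the supremum of $\|t\|_\nu$ over all $C^*$-seminorms $\|\cdot\|_\nu$ on $A\odot B$ (submultiplicative seminorms with $\|x^*x\|_\nu=\|x\|_\nu^2$), and $\|t\|_{\min}$ is the spatial norm, the supremum of $\|(\pi\odot\rho)(t)\|$ over all Hilbert space representations $\pi$ of $A$ and $\rho$ of $B$ (attained at any pair of faithful representations). Then $\mathfrak A$ is nuclear if and only if the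 component $A_i$ is nuclear for every $i\in\mathcal L$. -/

import Mathlib

open scoped TensorProduct ENNReal

universe u v w

noncomputable section

namespace GradedCStar

/-- A C⋆-seminorm on a complex ⋆-algebra `T`: a submultiplicative seminorm `N` with
`N (x⋆ x) = N x ^ 2`. No continuity is required. -/
structure IsCStarSeminorm {T : Type*} [NonUnitalRing T] [StarRing T] [Module ℂ T]
    (N : Seminorm ℂ T) : Prop where
  mul_le : ∀ x y : T, N (x * y) ≤ N x * N y
  star_mul_self : ∀ x : T, N (star x * x) = N x ^ 2

section TensorNorms

variable {A B : Type*} [NonUnitalCStarAlgebra A] [NonUnitalCStarAlgebra B]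

/-- The maximal C⋆-norm on the algebraic tensor product (a ⋆-algebra with
`(a₁ ⊗ b₁) (a₂ ⊗ b₂) = a₁ a₂ ⊗ b₁ b₂` and `(a ⊗ b)⋆ = a⋆ ⊗ b⋆`): the supremum of all
C⋆-seminorms. The supremum is taken in `[0, ∞]`, so that no junk value can arise. -/
def maxNorm (t : A ⊗[ℂ] B) : ℝ≥0∞ :=
  ⨆ (N : Seminorm ℂ (A ⊗[ℂ] B)) (_ : IsCStarSeminorm N), ENNReal.ofReal (N t)

section HilbertTensor

variable (H K : Type*) [NormedAddCommGroup H] [InnerProductSpace ℂ H]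
  [NormedAddCommGroup K] [InnerProductSpace ℂ K]

/-- The Hilbert space tensor product: the completion of the algebraic tensor product for the inner
product with `⟪h₁ ⊗ k₁, h₂ ⊗ k₂⟫ = ⟪h₁, h₂⟫ ⟪k₁, k₂⟫`. -/
def HilbertTensor : Type _ := UniformSpace.Completion (H ⊗[ℂ] K)

instance : NormedAddCommGroup (HilbertTensor H K) :=
  inferInstanceAs (NormedAddCommGroup (UniformSpace.Completion (H ⊗[ℂ] K)))

instance : InnerProductSpace ℂ (HilbertTensor H K) :=
  inferInstanceAs (InnerProductSpace ℂ (UniformSpace.Completion (H ⊗[ℂ] K)))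

instance : CompleteSpace (HilbertTensor H K) :=
  inferInstanceAs (CompleteSpace (UniformSpace.Completion (H ⊗[ℂ] K)))

variable {H K}

/-- The inclusion of the algebraic tensor product into the Hilbert space tensor product. -/
def toHilbertTensor : H ⊗[ℂ] K →ₗ[ℂ] HilbertTensor H K where
  toFun x := (x : UniformSpace.Completion (H ⊗[ℂ] K))
  map_add' x y := UniformSpace.Completion.coe_add x y
  map_smul' c x := UniformSpace.Completion.coe_smul c x

/-- The bounded operator `S ⊗ T` on the Hilbert space tensor product, the continuous extension of
`h ⊗ k ↦ S h ⊗ T k`. -/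
def opTensor (S : H →L[ℂ] H) (T : K →L[ℂ] K) : HilbertTensor H K →L[ℂ] HilbertTensor H K :=
  ContinuousLinearMap.completion (TensorProduct.mapL S T)

theorem opTensor_toHilbertTensor (S : H →L[ℂ] H) (T : K →L[ℂ] K) (x : H ⊗[ℂ] K) :
    opTensor S T (toHilbertTensor x) = toHilbertTensor (TensorProduct.mapL S T x) :=
  ContinuousLinearMap.completion_apply_coe (TensorProduct.mapL S T) x

theorem op_ext {f g : HilbertTensor H K →L[ℂ] HilbertTensor H K}
    (h : ∀ x : H ⊗[ℂ] K, f (toHilbertTensor x) = g (toHilbertTensor x)) : f = g :=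
  ContinuousLinearMap.ext fun y => UniformSpace.Completion.induction_on
    (p := fun y : UniformSpace.Completion (H ⊗[ℂ] K) => f y = g y) y
    (isClosed_eq f.continuous g.continuous) h

end HilbertTensor

/-- For representations `π` of `A` on `H` and `ρ` of `B` on `K`, the linear map `π ⊗ ρ` from the
algebraic tensor product to the bounded operators on the Hilbert space tensor product, with
`a ⊗ b ↦ π a ⊗ ρ b`. -/
def tensorRep {H K : Type*} [NormedAddCommGroup H] [InnerProductSpace ℂ H] [CompleteSpace H]
    [NormedAddCommGroup K] [InnerProductSpace ℂ K] [CompleteSpace K]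
    (π : A →⋆ₙₐ[ℂ] (H →L[ℂ] H)) (ρ : B →⋆ₙₐ[ℂ] (K →L[ℂ] K)) :
    A ⊗[ℂ] B →ₗ[ℂ] (HilbertTensor H K →L[ℂ] HilbertTensor H K) :=
  TensorProduct.lift <| LinearMap.mk₂ ℂ (fun a b => opTensor (π a) (ρ b))
    (fun a₁ a₂ b => op_ext fun x => by
      rw [add_apply, opTensor_toHilbertTensor, opTensor_toHilbertTensor, opTensor_toHilbertTensor,
        map_add, TensorProduct.mapL_add_left, ← map_add]; rfl)
    (fun c a b => op_ext fun x => by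
      rw [smul_apply, opTensor_toHilbertTensor, opTensor_toHilbertTensor, map_smul,
        TensorProduct.mapL_smul_left, ← map_smul]; rfl)
    (fun a b₁ b₂ => op_ext fun x => by
      rw [add_apply, opTensor_toHilbertTensor, opTensor_toHilbertTensor, opTensor_toHilbertTensor,
        map_add, TensorProduct.mapL_add_right, ← map_add]; rfl)
    (fun c a b => op_ext fun x => by
      rw [smul_apply, opTensor_toHilbertTensor, opTensor_toHilbertTensor, map_smul,
        TensorProduct.mapL_smul_right, ← map_smul]; rfl)

end TensorNorms

/-- The minimal (spatial) C⋆-norm on the algebraic tensor product: the supremum of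
`‖(π ⊗ ρ) t‖` over all Hilbert space representations `π` of `A` and `ρ` of `B`. It is attained at
every pair of faithful representations; those exist on Hilbert spaces in the universes of `A` and
`B` (direct sums of GNS representations), so that larger Hilbert spaces would add nothing. -/
def minNorm {A : Type u} {B : Type v} [NonUnitalCStarAlgebra A] [NonUnitalCStarAlgebra B]
    (t : A ⊗[ℂ] B) : ℝ≥0∞ :=
  ⨆ (H : Type u) (_ : NormedAddCommGroup H) (_ : InnerProductSpace ℂ H) (_ : CompleteSpace H)
    (K : Type v) (_ : NormedAddCommGroup K) (_ : InnerProductSpace ℂ K) (_ : CompleteSpace K)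
    (π : A →⋆ₙₐ[ℂ] (H →L[ℂ] H)) (ρ : B →⋆ₙₐ[ℂ] (K →L[ℂ] K)), ENNReal.ofReal ‖tensorRep π ρ t‖

/-- A C⋆-algebra `A` (not necessarily unital) is nuclear if for every C⋆-algebra `B` (not
necessarily unital, in an arbitrary universe) the maximal and the minimal C⋆-norm on the algebraic
tensor product of `A` and `B` coincide, i.e. the canonical map from the maximal onto the minimal
tensor product is injective. -/
def IsNuclear (A : Type u) [NonUnitalCStarAlgebra A] : Prop :=
  ∀ (B : Type v) [NonUnitalCStarAlgebra B] (t : A ⊗[ℂ] B), maxNorm t = minNorm t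

/-- A family of ⋆-subalgebras of a C⋆-algebra, indexed by a (meet-)semilattice `L`, is a grading
if its members are linearly independent (their sum is direct), total (their sum is dense), and
the product of the `i`-th and the `j`-th member is contained in the `i ⊓ j`-th. The members are
C⋆-subalgebras if they are moreover closed. -/
structure IsSemilatticeGrading {L A : Type*} [SemilatticeInf L] [NonUnitalCStarAlgebra A]
    (𝒜 : L → NonUnitalStarSubalgebra ℂ A) : Prop where
  independent : iSupIndep fun i => (𝒜 i).toNonUnitalSubalgebra.toSubmodule
  total : Dense ((⨆ i, (𝒜 i).toNonUnitalSubalgebra.toSubmodule : Submodule ℂ A) : Set A)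
  mul_mem : ∀ i j : L, ∀ a ∈ 𝒜 i, ∀ b ∈ 𝒜 j, a * b ∈ 𝒜 (i ⊓ j)

end GradedCStar

end

/-! Spatial seminorms are C⋆-seminorms, so nuclearity says that every C⋆-seminorm `N` on the
algebraic tensor product is at most the minimal norm. The tool for both directions is an action `θ`
of `A` on each component `A_m` by multipliers: components above `m` act by multiplication, all
others by zero. It is multiplicative because a meet lies above `m` exactly when both factors do. It
is well defined on the completion because the projection onto `A_m` along strictly smaller
components is contractive (`norm_le_norm_add_of_disjoint`, by functional calculus on a fiber
product).

If `A` is nuclear, a C⋆-seminorm on `A_m ⊗ B` induces through `θ` an operator seminorm on `A ⊗ B`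
that dominates it on `A_m ⊗ B`. Nuclearity of `A` bounds this by the minimal norm there, and
restriction of representations to `A_m` concludes.

If all components are nuclear, density and automatic continuity of C⋆-seminorms reduce the claim to
finite meet-closed index sets. Removing a maximal index `m` leaves an ideal, on which `N ≤ M` by
induction, `M` being the minimal norm. For `h = t⋆ t = k + j` with `k` from `A_m` and `j` in the
ideal, nuclearity gives `N k ≤ M k`, and `M k ≤ M h` because representations of `A_m` extend through
`θ` and kill the ideal. Expanding one factor at a time bounds `N (hⁿ)` by `M (h)ⁿ` times a linear
function of `n`. As `N (hⁿ) = N (h)ⁿ` for `n = 2ᵏ`, this forces `N h ≤ M h` (`le_of_decomposition`).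
-/

noncomputable section

namespace GradedCStar

/-! ### Automatic boundedness of actions -/

section BoundedAction

variable {V X : Type*} [AddCommGroup V] [Module ℂ V] [AddCommGroup X] [Module ℂ X]

/-- If the unitaries of a unital C⋆-algebra act contractively for a seminorm, then the whole
algebra acts boundedly. -/
theorem seminorm_action_le_of_unitary {R : Type*} [CStarAlgebra R] (N : Seminorm ℂ V)
    (θ : R →ₐ[ℂ] Module.End ℂ V) (h : ∀ u ∈ unitary R, ∀ v, N (θ u v) ≤ N v) (r : R) (v : V) :
    N (θ r v) ≤ 2 * ‖r‖ * N v := by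
  -- Each of the four coefficients has modulus at most `‖r‖ / 2`, whence the constant `2`.
  obtain ⟨u, c, hr, hc⟩ := CStarAlgebra.exists_sum_four_unitary r
  have hsum : θ r v = ∑ i, c i • θ (u i : R) v := by
    conv_lhs => rw [hr]
    simp [map_sum, LinearMap.sum_apply]
  calc N (θ r v) ≤ ∑ i, N (c i • θ (u i : R) v) := by
        rw [hsum]; exact Finset.le_sum_of_subadditive N (map_zero N).le (map_add_le_add N) _ _
    _ ≤ ∑ _i : Fin 4, ‖r‖ / 2 * N v := by
        gcongr with i
        rw [map_smul_eq_mul]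
        exact mul_le_mul (hc i) (h _ (u i).2 v) (apply_nonneg _ _) (by positivity)
    _ = 2 * ‖r‖ * N v := by simp; ring

/-- A C⋆-algebra acting by adjointable operators for a sesquilinear form `F` acts boundedly for
the seminorm that comes from `F`. -/
theorem seminorm_action_le {A : Type*} [NonUnitalCStarAlgebra A] (N : Seminorm ℂ V)
    (F : V →ₗ⋆[ℂ] V →ₗ[ℂ] X) (n : X → ℝ) (hN : ∀ v, N v ^ 2 = n (F v v))
    (θ : A →ₙₐ[ℂ] Module.End ℂ V) (hF : ∀ a v w, F (θ a v) w = F v (θ (star a) w))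
    (a : A) (v : V) : N (θ a v) ≤ 2 * ‖a‖ * N v := by
  have hlift : ∀ (r : Unitization ℂ A) (v w : V),
      F (Unitization.lift θ r v) w = F v (Unitization.lift θ (star r) w) := by
    intro r v w
    simp [Unitization.lift_apply, hF, Module.algebraMap_end_apply]
  -- In the unitization, unitaries preserve the form `F`, hence the seminorm.
  have key := seminorm_action_le_of_unitary N (Unitization.lift θ) (fun u hu v => by
    refine (sq_le_sq₀ (apply_nonneg _ _) (apply_nonneg _ _)).1 (le_of_eq ?_)
    rw [hN, hlift, ← Module.End.mul_apply, ← map_mul, Unitary.star_mul_self_of_mem hu, map_one,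
      Module.End.one_apply, ← hN]) (a : Unitization ℂ A) v
  simpa [Unitization.norm_inr] using key

end BoundedAction

/-! ### Powers without a unit -/

section Powers

variable {T : Type*} [NonUnitalRing T]

/-- The `n`-th member is the power `x ^ (n + 1)`. -/
def powSucc (x : T) : ℕ → T
  | 0 => x
  | n + 1 => powSucc x n * x

theorem powSucc_mul (x : T) (m n : ℕ) : powSucc x m * powSucc x n = powSucc x (m + n + 1) := by
  induction n with
  | zero => rfl
  | succ n ih => rw [powSucc, ← mul_assoc, ih]; rfl

theorem isSelfAdjoint_powSucc [StarRing T] {x : T} (hx : IsSelfAdjoint x) (n : ℕ) :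
    IsSelfAdjoint (powSucc x n) := by
  induction n with
  | zero => exact hx
  | succ n ih =>
    have h := powSucc_mul x 0 n
    rw [zero_add] at h
    rw [IsSelfAdjoint, ← h, star_mul, ih.star_eq]
    change powSucc x n * star x = x * powSucc x n
    rw [hx.star_eq]
    exact h.symm

end Powers

/-! ### Comparison of C⋆-seminorms by growth of powers -/

section StarAlgebra

variable {T : Type*} [NonUnitalRing T] [StarRing T] [Module ℂ T] {N M : Seminorm ℂ T}

namespace IsCStarSeminorm

/-- Cancel `N x` in `N x ^ 2 = N (x⋆ x) ≤ N (x⋆) * N x`. -/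
theorem map_star (hN : IsCStarSeminorm N) (x : T) : N (star x) = N x := by
  have key : ∀ x : T, N x ≤ N (star x) := fun x => by
    rcases (apply_nonneg N x).eq_or_lt with h | h
    · rw [← h]; exact apply_nonneg _ _
    · have := hN.mul_le (star x) x
      rw [hN.star_mul_self, sq] at this
      exact le_of_mul_le_mul_right this h
  exact le_antisymm (by simpa using key (star x)) (key x)

theorem powSucc_two_pow (hN : IsCStarSeminorm N) {x : T} (hx : IsSelfAdjoint x) (k : ℕ) :
    N (powSucc x (2 ^ k - 1)) = N x ^ 2 ^ k := by
  induction k with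
  | zero => simp [powSucc]
  | succ k ih =>
    have h1 : 2 ^ (k + 1) - 1 = (2 ^ k - 1) + (2 ^ k - 1) + 1 := by
      have := Nat.one_le_two_pow (n := k); rw [pow_succ]; omega
    rw [h1, ← powSucc_mul]
    nth_rewrite 1 [← (isSelfAdjoint_powSucc hx (2 ^ k - 1)).star_eq]
    rw [hN.star_mul_self, ih, ← pow_mul, pow_succ]

/-- A self-adjoint `h = k + j` with `N k ≤ M h`, where `N ≤ M` on all `hⁿ j`, satisfies
`N h ≤ M h`. -/
theorem le_of_decomposition (hN : IsCStarSeminorm N) (hM : IsCStarSeminorm M) {h k j : T}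
    (hh : IsSelfAdjoint h) (hkj : h = k + j) (hk : N k ≤ M h)
    (hj : ∀ n, N (powSucc h n * j) ≤ M (powSucc h n * j)) : N h ≤ M h := by
  set α := M h with hα
  have hα0 : 0 ≤ α := apply_nonneg _ _
  have hMpow : ∀ n, M (powSucc h n) ≤ α ^ (n + 1) := by
    intro n
    induction n with
    | zero => simp [powSucc, hα]
    | succ n ih =>
      rw [pow_succ]
      exact (hM.mul_le _ _).trans (by gcongr)
  -- In `hⁿ⁺¹ (k + j)` the first summand costs a factor `α`, the second at most `αⁿ⁺¹ M j`. The
  -- factor `α` on the left avoids a division, as `α` may vanish.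
  have hpow : ∀ n : ℕ, N (powSucc h n) * α ≤ α ^ (n + 1) * (N h + n * M j) := by
    intro n
    induction n with
    | zero => simp [powSucc, mul_comm]
    | succ n ih =>
      have h1 : powSucc h (n + 1) = powSucc h n * k + powSucc h n * j := by
        rw [powSucc]; nth_rewrite 2 [hkj]; rw [mul_add]
      have h2 : N (powSucc h (n + 1)) ≤ N (powSucc h n) * α + α ^ (n + 1) * M j := by
        rw [h1]
        refine (map_add_le_add _ _ _).trans (add_le_add ?_ ?_)
        · exact (hN.mul_le _ _).trans (by gcongr)
        · exact (hj n).trans ((hM.mul_le _ _).trans (by gcongr; exact hMpow n))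
      calc N (powSucc h (n + 1)) * α ≤ (N (powSucc h n) * α + α ^ (n + 1) * M j) * α := by gcongr
        _ ≤ (α ^ (n + 1) * (N h + n * M j) + α ^ (n + 1) * M j) * α := by gcongr
        _ = _ := by push_cast; ring
  by_contra! hlt
  have hNh : 0 < N h := hα0.trans_lt hlt
  -- For `α = 0` already `N (h²) = 0`. Otherwise `q = N h / α > 1` would satisfy `q ^ 2ⁿ ≤ const *
  -- 2ⁿ` for all `n`.
  rcases hα0.eq_or_lt with h0 | h0
  · have h1 : N (powSucc h 1) ≤ 0 := by
      have h1 : powSucc h 1 = h * k + h * j := by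
        change h * h = _; nth_rewrite 2 [hkj]; rw [mul_add]
      rw [h1]
      refine (map_add_le_add _ _ _).trans ?_
      have h2 := hN.mul_le h k
      have h3 := (hj 0).trans (hM.mul_le _ _)
      have h4 : N k = 0 := le_antisymm (hk.trans h0.symm.le) (apply_nonneg _ _)
      change N (h * j) ≤ M h * M j at h3
      rw [← hα, ← h0, zero_mul] at h3
      rw [h4, mul_zero] at h2
      linarith
    have h2 := hN.powSucc_two_pow hh 1
    norm_num at h2
    rw [h2] at h1
    have : 0 < N h ^ 2 := by positivity
    linarith
  · set q := N h / α with hq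
    have hq1 : 1 < q := (one_lt_div h0).2 hlt
    have hb : ∀ n : ℕ, q ^ 2 ^ n ≤ (N h + M j) / α * 2 ^ n := by
      intro n
      have h1 := hpow (2 ^ n - 1)
      rw [hN.powSucc_two_pow hh, Nat.sub_add_cancel Nat.one_le_two_pow] at h1
      have h2 : ((2 ^ n - 1 : ℕ) : ℝ) ≤ 2 ^ n := by
        have : 2 ^ n - 1 ≤ 2 ^ n := Nat.sub_le _ _
        exact_mod_cast this
      have h3 : (1 : ℝ) ≤ 2 ^ n := one_le_pow₀ (by norm_num)
      have hj0 : 0 ≤ M j := apply_nonneg _ _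
      have h4 : N h + ((2 ^ n - 1 : ℕ) : ℝ) * M j ≤ (N h + M j) * 2 ^ n := by nlinarith
      rw [hq, div_pow, div_mul_eq_mul_div, div_le_div_iff₀ (by positivity) h0]
      calc N h ^ 2 ^ n * α ≤ _ := h1
        _ ≤ α ^ 2 ^ n * ((N h + M j) * 2 ^ n) := by gcongr
        _ = _ := by ring
    have ht : Filter.Tendsto (fun n : ℕ => (n : ℝ) ^ 1 / q ^ n) Filter.atTop (nhds 0) :=
      tendsto_pow_const_div_const_pow_of_one_lt 1 hq1
    have ht2 := (ht.comp (tendsto_pow_atTop_atTop_of_one_lt (one_lt_two : 1 < 2))).const_mul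
      ((N h + M j) / α)
    rw [mul_zero] at ht2
    obtain ⟨n, hn⟩ := (ht2.eventually (gt_mem_nhds zero_lt_one)).exists
    have hqn : 0 < q ^ 2 ^ n := by positivity
    have := hb n
    simp only [Function.comp, pow_one, Nat.cast_pow, Nat.cast_ofNat] at hn
    rw [← mul_div_assoc, div_lt_one hqn] at hn
    linarith

end IsCStarSeminorm

variable (T) [IsScalarTower ℂ T T] [SMulCommClass ℂ T T] [StarModule ℂ T]

/-- The sesquilinear form `(x, y) ↦ x⋆ y`. -/
def starMulForm : T →ₗ⋆[ℂ] T →ₗ[ℂ] T :=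
  LinearMap.mk₂'ₛₗ (starRingEnd ℂ) (RingHom.id ℂ) (fun x y => star x * y)
    (fun x y z => by simp [add_mul]) (fun c x y => by simp [smul_mul_assoc])
    (fun x y z => by simp [mul_add]) (fun c x y => by simp [mul_smul_comm])

variable {T}

@[simp] theorem starMulForm_apply (x y : T) : starMulForm T x y = star x * y := rfl

namespace IsCStarSeminorm

theorem action_le (hN : IsCStarSeminorm N) {A : Type*} [NonUnitalCStarAlgebra A]
    (θ : A →ₙₐ[ℂ] Module.End ℂ T) (hθ : ∀ a v w, star (θ a v) * w = star v * θ (star a) w)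
    (a : A) (v : T) : N (θ a v) ≤ 2 * ‖a‖ * N v :=
  seminorm_action_le N (starMulForm T) N (fun v => by simp [hN.star_mul_self]) θ (by simpa using hθ)
    a v

end IsCStarSeminorm

end StarAlgebra

/-! ### Operators on the Hilbert space tensor product -/

section HilbertTensorOperators

variable {H K : Type*} [NormedAddCommGroup H] [InnerProductSpace ℂ H]
  [NormedAddCommGroup K] [InnerProductSpace ℂ K]

theorem opTensor_mul (S₁ S₂ : H →L[ℂ] H) (T₁ T₂ : K →L[ℂ] K) :
    opTensor (S₁ * S₂) (T₁ * T₂) = opTensor S₁ T₁ * opTensor S₂ T₂ :=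
  op_ext fun x => by
    rw [mul_apply_eq_comp, opTensor_toHilbertTensor, opTensor_toHilbertTensor,
      opTensor_toHilbertTensor, TensorProduct.mapL_mul]
    rfl

theorem inner_toHilbertTensor (x y : H ⊗[ℂ] K) :
    inner ℂ (toHilbertTensor x) (toHilbertTensor y) = inner ℂ x y :=
  UniformSpace.Completion.inner_coe x y

theorem inner_mapL [CompleteSpace H] [CompleteSpace K] (S : H →L[ℂ] H) (T : K →L[ℂ] K)
    (x y : H ⊗[ℂ] K) :
    inner ℂ (TensorProduct.mapL (star S) (star T) x) y = inner ℂ x (TensorProduct.mapL S T y) := by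
  induction x with
  | zero => simp
  | add x₁ x₂ h₁ h₂ => rw [map_add, inner_add_left, inner_add_left, h₁, h₂]
  | tmul h k =>
    induction y with
    | zero => simp
    | add y₁ y₂ h₁ h₂ => rw [map_add, inner_add_right, inner_add_right, h₁, h₂]
    | tmul h' k' =>
      rw [TensorProduct.mapL_tmul, TensorProduct.mapL_tmul, TensorProduct.inner_tmul,
        TensorProduct.inner_tmul, ContinuousLinearMap.star_eq_adjoint,
        ContinuousLinearMap.star_eq_adjoint, ContinuousLinearMap.adjoint_inner_left,
        ContinuousLinearMap.adjoint_inner_left]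

theorem denseRange_toHilbertTensor :
    DenseRange (toHilbertTensor : H ⊗[ℂ] K → HilbertTensor H K) :=
  UniformSpace.Completion.denseRange_coe

theorem star_opTensor [CompleteSpace H] [CompleteSpace K] (S : H →L[ℂ] H) (T : K →L[ℂ] K) :
    star (opTensor S T) = opTensor (star S) (star T) := by
  rw [ContinuousLinearMap.star_eq_adjoint, eq_comm, ContinuousLinearMap.eq_adjoint_iff]
  intro x y
  refine denseRange_toHilbertTensor.induction_on₂ (p := fun x y =>
    inner ℂ (opTensor (star S) (star T) x) y = inner ℂ x (opTensor S T y)) ?_ ?_ x y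
  · exact isClosed_eq (by fun_prop) (by fun_prop)
  · intro x y
    rw [opTensor_toHilbertTensor, opTensor_toHilbertTensor, inner_toHilbertTensor,
      inner_toHilbertTensor, inner_mapL]

end HilbertTensorOperators

/-! ### Spatial seminorms and the criterion for nuclearity -/

section TensorRep

variable {A B : Type*} [NonUnitalCStarAlgebra A] [NonUnitalCStarAlgebra B]
  {H K : Type*} [NormedAddCommGroup H] [InnerProductSpace ℂ H] [CompleteSpace H]
  [NormedAddCommGroup K] [InnerProductSpace ℂ K] [CompleteSpace K]
  (π : A →⋆ₙₐ[ℂ] (H →L[ℂ] H)) (ρ : B →⋆ₙₐ[ℂ] (K →L[ℂ] K))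

@[simp] theorem tensorRep_tmul (a : A) (b : B) :
    tensorRep π ρ (a ⊗ₜ b) = opTensor (π a) (ρ b) := rfl

theorem tensorRep_mul (x y : A ⊗[ℂ] B) :
    tensorRep π ρ (x * y) = tensorRep π ρ x * tensorRep π ρ y := by
  induction x with
  | zero => simp
  | add x₁ x₂ h₁ h₂ => rw [add_mul, map_add, map_add, h₁, h₂, add_mul]
  | tmul a b =>
    induction y with
    | zero => simp
    | add y₁ y₂ h₁ h₂ => rw [mul_add, map_add, map_add, h₁, h₂, mul_add]
    | tmul a' b' =>
      rw [Algebra.TensorProduct.tmul_mul_tmul, tensorRep_tmul, tensorRep_tmul, tensorRep_tmul,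
        map_mul, map_mul, opTensor_mul]

theorem tensorRep_star (x : A ⊗[ℂ] B) : tensorRep π ρ (star x) = star (tensorRep π ρ x) := by
  induction x with
  | zero => simp
  | add x₁ x₂ h₁ h₂ => rw [star_add, map_add, map_add, h₁, h₂, star_add]
  | tmul a b =>
    rw [TensorProduct.star_tmul, tensorRep_tmul, tensorRep_tmul, star_opTensor, map_star, map_star]

/-- The C⋆-seminorm `t ↦ ‖(π ⊗ ρ) t‖`. -/
def repSeminorm : Seminorm ℂ (A ⊗[ℂ] B) :=
  (normSeminorm ℂ (HilbertTensor H K →L[ℂ] HilbertTensor H K)).comp (tensorRep π ρ)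

theorem repSeminorm_apply (t : A ⊗[ℂ] B) : repSeminorm π ρ t = ‖tensorRep π ρ t‖ := rfl

theorem isCStarSeminorm_repSeminorm : IsCStarSeminorm (repSeminorm π ρ) where
  mul_le x y := by
    simp only [repSeminorm_apply, tensorRep_mul]
    exact norm_mul_le _ _
  star_mul_self x := by
    simp only [repSeminorm_apply, tensorRep_mul, tensorRep_star]
    rw [CStarRing.norm_star_mul_self, sq]

end TensorRep

theorem minNorm_le_maxNorm {A : Type u} {B : Type v} [NonUnitalCStarAlgebra A]
    [NonUnitalCStarAlgebra B] (t : A ⊗[ℂ] B) : minNorm t ≤ maxNorm t := by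
  refine iSup_le fun H => iSup_le fun _ => iSup_le fun _ => iSup_le fun _ => iSup_le fun K =>
    iSup_le fun _ => iSup_le fun _ => iSup_le fun _ => iSup_le fun π => iSup_le fun ρ => ?_
  exact le_iSup₂_of_le (repSeminorm π ρ) (isCStarSeminorm_repSeminorm π ρ) le_rfl

theorem ofReal_norm_tensorRep_le_minNorm {A : Type u} {B : Type v} [NonUnitalCStarAlgebra A]
    [NonUnitalCStarAlgebra B] {H : Type u} [NormedAddCommGroup H] [InnerProductSpace ℂ H]
    [CompleteSpace H] {K : Type v} [NormedAddCommGroup K] [InnerProductSpace ℂ K] [CompleteSpace K]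
    (π : A →⋆ₙₐ[ℂ] (H →L[ℂ] H)) (ρ : B →⋆ₙₐ[ℂ] (K →L[ℂ] K)) (t : A ⊗[ℂ] B) :
    ENNReal.ofReal ‖tensorRep π ρ t‖ ≤ minNorm t :=
  le_iSup_of_le H <| le_iSup_of_le _ <| le_iSup_of_le _ <| le_iSup_of_le _ <| le_iSup_of_le K <|
    le_iSup_of_le _ <| le_iSup_of_le _ <| le_iSup_of_le _ <| le_iSup_of_le π <| le_iSup_of_le ρ
    le_rfl

theorem minNorm_le_iff {A : Type u} {B : Type v} [NonUnitalCStarAlgebra A]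
    [NonUnitalCStarAlgebra B] {t : A ⊗[ℂ] B} {r : ℝ≥0∞} : minNorm t ≤ r ↔
    ∀ (H : Type u) [NormedAddCommGroup H] [InnerProductSpace ℂ H] [CompleteSpace H]
      (K : Type v) [NormedAddCommGroup K] [InnerProductSpace ℂ K] [CompleteSpace K]
      (π : A →⋆ₙₐ[ℂ] (H →L[ℂ] H)) (ρ : B →⋆ₙₐ[ℂ] (K →L[ℂ] K)),
      ENNReal.ofReal ‖tensorRep π ρ t‖ ≤ r := by
  simp only [minNorm, iSup_le_iff]

theorem isNuclear_iff {A : Type u} [NonUnitalCStarAlgebra A] : IsNuclear.{u, v} A ↔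
    ∀ (B : Type v) [NonUnitalCStarAlgebra B] (N : Seminorm ℂ (A ⊗[ℂ] B)), IsCStarSeminorm N →
      ∀ t : A ⊗[ℂ] B, ENNReal.ofReal (N t) ≤ minNorm t := by
  refine forall_congr' fun B => forall_congr' fun _ => ⟨fun h N hN t => ?_, fun h t => ?_⟩
  · exact (le_iSup₂_of_le N hN le_rfl).trans (h t).le
  · exact (iSup₂_le fun N hN => h N hN t).antisymm (minNorm_le_maxNorm t)

/-! ### Functoriality in the first leg -/

section Functoriality

variable {C A B : Type*} [NonUnitalCStarAlgebra A] [NonUnitalCStarAlgebra B]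
  [NonUnitalCStarAlgebra C]

/-- The ⋆-homomorphism `φ ⊗ id` of algebraic tensor products, as a linear map. -/
abbrev tensorMapLeft (B : Type*) [NonUnitalCStarAlgebra B] (φ : C →⋆ₙₐ[ℂ] A) :
    C ⊗[ℂ] B →ₗ[ℂ] A ⊗[ℂ] B :=
  LinearMap.rTensor B (φ : C →ₗ[ℂ] A)

theorem tensorMapLeft_mul (φ : C →⋆ₙₐ[ℂ] A) (x y : C ⊗[ℂ] B) :
    tensorMapLeft B φ (x * y) = tensorMapLeft B φ x * tensorMapLeft B φ y := by
  induction x with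
  | zero => simp
  | add x₁ x₂ h₁ h₂ => rw [add_mul, map_add, map_add, h₁, h₂, add_mul]
  | tmul a b =>
    induction y with
    | zero => simp
    | add y₁ y₂ h₁ h₂ => rw [mul_add, map_add, map_add, h₁, h₂, mul_add]
    | tmul a' b' => simp

theorem tensorMapLeft_star (φ : C →⋆ₙₐ[ℂ] A) (x : C ⊗[ℂ] B) :
    tensorMapLeft B φ (star x) = star (tensorMapLeft B φ x) := by
  induction x with
  | zero => simp
  | add x₁ x₂ h₁ h₂ => rw [star_add, map_add, map_add, h₁, h₂, star_add]
  | tmul a b => simp [TensorProduct.star_tmul, map_star]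

theorem IsCStarSeminorm.comp_tensorMapLeft {N : Seminorm ℂ (A ⊗[ℂ] B)} (hN : IsCStarSeminorm N)
    (φ : C →⋆ₙₐ[ℂ] A) : IsCStarSeminorm (N.comp (tensorMapLeft B φ)) where
  mul_le x y := by
    simp only [Seminorm.comp_apply, tensorMapLeft_mul]
    exact hN.mul_le _ _
  star_mul_self x := by
    simp only [Seminorm.comp_apply, tensorMapLeft_mul, tensorMapLeft_star]
    exact hN.star_mul_self _

theorem tensorRep_comp {H K : Type*} [NormedAddCommGroup H] [InnerProductSpace ℂ H]
    [CompleteSpace H] [NormedAddCommGroup K] [InnerProductSpace ℂ K] [CompleteSpace K]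
    (π : A →⋆ₙₐ[ℂ] (H →L[ℂ] H)) (ρ : B →⋆ₙₐ[ℂ] (K →L[ℂ] K)) (φ : C →⋆ₙₐ[ℂ] A) (t : C ⊗[ℂ] B) :
    tensorRep (π.comp φ) ρ t = tensorRep π ρ (tensorMapLeft B φ t) := by
  induction t with
  | zero => simp
  | add x₁ x₂ h₁ h₂ => rw [map_add, map_add, map_add, h₁, h₂]
  | tmul a b => simp

end Functoriality

theorem minNorm_tensorMapLeft_le {C A : Type u} {B : Type v} [NonUnitalCStarAlgebra A]
    [NonUnitalCStarAlgebra B] [NonUnitalCStarAlgebra C] (φ : C →⋆ₙₐ[ℂ] A) (t : C ⊗[ℂ] B) :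
    minNorm (tensorMapLeft B φ t) ≤ minNorm t := by
  refine minNorm_le_iff.2 fun H _ _ _ K _ _ _ π ρ => ?_
  rw [← tensorRep_comp]
  exact ofReal_norm_tensorRep_le_minNorm _ _ _

/-! ### Seminorms induced through an action -/

section TensorAction

variable {A B C : Type*} [NonUnitalCStarAlgebra A] [NonUnitalCStarAlgebra B]
  [NonUnitalCStarAlgebra C]

/-- The action of the algebraic tensor product of `A` and `B` on that of `C` and `B` that comes
from an action of `A` on `C`. -/
def tensorAction (B : Type*) [NonUnitalCStarAlgebra B] (θ : A →ₙₐ[ℂ] Module.End ℂ C) :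
    A ⊗[ℂ] B →ₗ[ℂ] Module.End ℂ (C ⊗[ℂ] B) :=
  TensorProduct.homTensorHomMap (RingHom.id ℂ) C B C B ∘ₗ
    TensorProduct.map (θ : A →ₗ[ℂ] Module.End ℂ C) (LinearMap.mul ℂ B)

variable {θ : A →ₙₐ[ℂ] Module.End ℂ C}

@[simp] theorem tensorAction_tmul_tmul (a : A) (b : B) (c : C) (b' : B) :
    tensorAction B θ (a ⊗ₜ b) (c ⊗ₜ b') = θ a c ⊗ₜ (b * b') := by
  simp [tensorAction]

theorem tensorAction_mul (x y : A ⊗[ℂ] B) (z : C ⊗[ℂ] B) :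
    tensorAction B θ (x * y) z = tensorAction B θ x (tensorAction B θ y z) := by
  induction x with
  | zero => simp
  | add x₁ x₂ h₁ h₂ => rw [add_mul, map_add, map_add, LinearMap.add_apply, h₁, h₂,
      LinearMap.add_apply]
  | tmul a b =>
    induction y with
    | zero => simp
    | add y₁ y₂ h₁ h₂ => rw [mul_add, map_add, map_add, LinearMap.add_apply, h₁, h₂,
        LinearMap.add_apply, map_add]
    | tmul a' b' =>
      induction z with
      | zero => simp
      | add z₁ z₂ h₁ h₂ => simp only [map_add, h₁, h₂]
      | tmul c b'' => simp [mul_assoc]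

theorem star_tensorAction_mul (hθ : ∀ a x y, star (θ a x) * y = star x * θ (star a) y)
    (x : A ⊗[ℂ] B) (y z : C ⊗[ℂ] B) :
    star (tensorAction B θ x y) * z = star y * tensorAction B θ (star x) z := by
  induction x with
  | zero => simp
  | add x₁ x₂ h₁ h₂ => simp only [map_add, LinearMap.add_apply, star_add, add_mul, mul_add, h₁, h₂]
  | tmul a b =>
    induction y with
    | zero => simp
    | add y₁ y₂ h₁ h₂ => simp only [map_add, star_add, add_mul, h₁, h₂]
    | tmul c b' =>
      induction z with
      | zero => simp
      | add z₁ z₂ h₁ h₂ => simp only [map_add, mul_add, h₁, h₂]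
      | tmul c' b'' => simp [TensorProduct.star_tmul, hθ, mul_assoc]

/-- An action of `A` on `C` makes `A` act on the left leg of a tensor product. -/
def actLeft (V : Type*) [AddCommGroup V] [Module ℂ V] (θ : A →ₙₐ[ℂ] Module.End ℂ C) :
    A →ₙₐ[ℂ] Module.End ℂ (C ⊗[ℂ] V) where
  toFun a := LinearMap.rTensor V (θ a)
  map_smul' c a := by simp
  map_zero' := by simp
  map_add' a b := by simp [LinearMap.rTensor_add]
  map_mul' a b := by simp [LinearMap.rTensor_mul]

@[simp] theorem actLeft_tmul {V : Type*} [AddCommGroup V] [Module ℂ V] (a : A) (c : C) (v : V) :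
    actLeft V θ a (c ⊗ₜ v) = θ a c ⊗ₜ v := rfl

/-- The action of `B` on the right leg of a tensor product. -/
def actRight (C B : Type*) [NonUnitalCStarAlgebra B] [NonUnitalCStarAlgebra C] :
    B →ₙₐ[ℂ] Module.End ℂ (C ⊗[ℂ] B) where
  toFun b := LinearMap.lTensor C (LinearMap.mul ℂ B b)
  map_smul' c a := by simp
  map_zero' := by simp
  map_add' a b := by simp [LinearMap.lTensor_add]
  map_mul' a b := TensorProduct.ext' fun c b' => by simp [mul_assoc]

@[simp] theorem actRight_tmul (b : B) (c : C) (b' : B) :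
    actRight C B b (c ⊗ₜ b') = c ⊗ₜ (b * b') := rfl

theorem tensorAction_tmul (a : A) (b : B) (z : C ⊗[ℂ] B) :
    tensorAction B θ (a ⊗ₜ b) z = actLeft B θ a (actRight C B b z) := by
  induction z with
  | zero => simp
  | add z₁ z₂ h₁ h₂ => simp only [map_add, h₁, h₂]
  | tmul c b' => simp

theorem star_actLeft_mul (hθ : ∀ a x y, star (θ a x) * y = star x * θ (star a) y)
    (a : A) (y z : C ⊗[ℂ] B) :
    star (actLeft B θ a y) * z = star y * actLeft B θ (star a) z := by
  induction y with
  | zero => simp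
  | add y₁ y₂ h₁ h₂ => simp only [map_add, star_add, add_mul, h₁, h₂]
  | tmul c b' =>
    induction z with
    | zero => simp
    | add z₁ z₂ h₁ h₂ => simp only [map_add, mul_add, h₁, h₂]
    | tmul c' b'' => simp [TensorProduct.star_tmul, hθ]

theorem star_actRight_mul (b : B) (y z : C ⊗[ℂ] B) :
    star (actRight C B b y) * z = star y * actRight C B (star b) z := by
  induction y with
  | zero => simp
  | add y₁ y₂ h₁ h₂ => simp only [map_add, star_add, add_mul, h₁, h₂]
  | tmul c b' =>
    induction z with
    | zero => simp
    | add z₁ z₂ h₁ h₂ => simp only [map_add, mul_add, h₁, h₂]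
    | tmul c' b'' => simp [TensorProduct.star_tmul, mul_assoc]

namespace IsCStarSeminorm

/-- The two legs act separately by adjointable operators, and each costs the factor `2` of the
unitary decomposition. -/
theorem tensorAction_tmul_le {N : Seminorm ℂ (C ⊗[ℂ] B)} (hN : IsCStarSeminorm N)
    (hθ : ∀ a x y, star (θ a x) * y = star x * θ (star a) y) (a : A) (b : B) (z : C ⊗[ℂ] B) :
    N (tensorAction B θ (a ⊗ₜ b) z) ≤ 4 * ‖a‖ * ‖b‖ * N z := by
  rw [tensorAction_tmul]
  calc N (actLeft B θ a (actRight C B b z)) ≤ 2 * ‖a‖ * N (actRight C B b z) :=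
        hN.action_le _ (star_actLeft_mul hθ) _ _
    _ ≤ 2 * ‖a‖ * (2 * ‖b‖ * N z) := by
        gcongr
        exact hN.action_le _ star_actRight_mul _ _
    _ = _ := by ring

theorem exists_tensorAction_le {N : Seminorm ℂ (C ⊗[ℂ] B)} (hN : IsCStarSeminorm N)
    (hθ : ∀ a x y, star (θ a x) * y = star x * θ (star a) y) (x : A ⊗[ℂ] B) :
    ∃ r, 0 ≤ r ∧ ∀ z, N (tensorAction B θ x z) ≤ r * N z := by
  induction x with
  | zero => exact ⟨0, le_rfl, by simp⟩
  | add x₁ x₂ h₁ h₂ =>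
    obtain ⟨r₁, hr₁, h₁⟩ := h₁
    obtain ⟨r₂, hr₂, h₂⟩ := h₂
    refine ⟨r₁ + r₂, by positivity, fun z => ?_⟩
    rw [map_add, LinearMap.add_apply, add_mul]
    exact (map_add_le_add _ _ _).trans (add_le_add (h₁ z) (h₂ z))
  | tmul a b => exact ⟨4 * ‖a‖ * ‖b‖, by positivity, hN.tensorAction_tmul_le hθ a b⟩

/-- Automatic continuity: for `z = a ⊗ b`, the bound for multiplication by `z`, applied to `z⋆`,
controls `N (z z⋆) = N z ^ 2`, and one factor `N z` cancels. -/
theorem map_tmul_le {N : Seminorm ℂ (A ⊗[ℂ] B)} (hN : IsCStarSeminorm N) (a : A) (b : B) :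
    N (a ⊗ₜ b) ≤ 4 * ‖a‖ * ‖b‖ := by
  rcases (apply_nonneg N (a ⊗ₜ b)).eq_or_lt with h | h
  · rw [← h]; positivity
  have h1 := hN.tensorAction_tmul_le (θ := NonUnitalAlgHom.lmul ℂ A)
    (fun a x y => by simp [mul_assoc]) a b (star (a ⊗ₜ b))
  have h2 : tensorAction B (NonUnitalAlgHom.lmul ℂ A) (a ⊗ₜ b) (star (a ⊗ₜ b)) =
      star (star (a ⊗ₜ[ℂ] b)) * star (a ⊗ₜ b) := by
    simp [TensorProduct.star_tmul]
  rw [h2, hN.star_mul_self, hN.map_star, sq] at h1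
  exact le_of_mul_le_mul_right h1 h

/-- The C⋆-seminorm `x ↦ sup {N (x y) | N y ≤ 1}` that a C⋆-seminorm `N` on the tensor product of
`C` and `B` induces on the tensor product of `A` and `B` through an action of `A` on `C`. -/
def induced (N : Seminorm ℂ (C ⊗[ℂ] B)) (θ : A →ₙₐ[ℂ] Module.End ℂ C) : Seminorm ℂ (A ⊗[ℂ] B) :=
  ⨆ y : {y : C ⊗[ℂ] B // N y ≤ 1}, N.comp ((tensorAction B θ).flip y)

section Induced

variable {N : Seminorm ℂ (C ⊗[ℂ] B)} (hN : IsCStarSeminorm N)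
  (hθ : ∀ a x y, star (θ a x) * y = star x * θ (star a) y)

include hN hθ

theorem bddAbove_range_induced (x : A ⊗[ℂ] B) : BddAbove (Set.range
    fun y : {y : C ⊗[ℂ] B // N y ≤ 1} => N (tensorAction B θ x y)) := by
  obtain ⟨r, hr, h⟩ := hN.exists_tensorAction_le hθ x
  refine ⟨r, ?_⟩
  rintro _ ⟨y, rfl⟩
  exact (h y).trans (mul_le_of_le_one_right hr y.2)

theorem induced_apply (x : A ⊗[ℂ] B) :
    induced N θ x = ⨆ y : {y : C ⊗[ℂ] B // N y ≤ 1}, N (tensorAction B θ x y) := by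
  rw [induced, Seminorm.iSup_apply]
  · rfl
  · exact Seminorm.bddAbove_range_iff.2 fun x => hN.bddAbove_range_induced hθ x

theorem tensorAction_le_induced (x : A ⊗[ℂ] B) (y : C ⊗[ℂ] B) :
    N (tensorAction B θ x y) ≤ induced N θ x * N y := by
  rcases (apply_nonneg N y).eq_or_lt with h | h
  -- A null vector cannot be rescaled to the unit ball; boundedness shows that its image is null as
  -- well.
  · obtain ⟨r, hr, hx⟩ := hN.exists_tensorAction_le hθ x
    simpa [← h] using hx y
  · have hy : N (((N y)⁻¹ : ℂ) • y) ≤ 1 := by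
      rw [map_smul_eq_mul, norm_inv, Complex.norm_real, Real.norm_of_nonneg h.le,
        inv_mul_cancel₀ h.ne']
    have h1 := le_ciSup (hN.bddAbove_range_induced hθ x) ⟨_, hy⟩
    rw [← hN.induced_apply hθ] at h1
    simp only [map_smul, map_smul_eq_mul, norm_inv, Complex.norm_real,
      Real.norm_of_nonneg h.le] at h1
    rwa [inv_mul_le_iff₀ h, mul_comm] at h1

theorem induced_le {x : A ⊗[ℂ] B} {r : ℝ} (hr : 0 ≤ r)
    (h : ∀ y, N y ≤ 1 → N (tensorAction B θ x y) ≤ r) : induced N θ x ≤ r := by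
  rw [hN.induced_apply hθ]
  exact Real.iSup_le (fun y => h y y.2) hr

/-- As for the operator norm on a Hilbert module: `N (x z) ^ 2 = N (z⋆ (x⋆ x z))` is at most the
induced seminorm of `x⋆ x` when `N z ≤ 1`. -/
theorem isCStarSeminorm_induced : IsCStarSeminorm (induced N θ) := by
  have hmul : ∀ x y : A ⊗[ℂ] B, induced N θ (x * y) ≤ induced N θ x * induced N θ y := fun x y => by
    refine hN.induced_le hθ (by positivity) fun z hz => ?_
    rw [tensorAction_mul]
    refine (hN.tensorAction_le_induced hθ _ _).trans ?_
    gcongr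
    exact (hN.tensorAction_le_induced hθ _ _).trans (mul_le_of_le_one_right (by positivity) hz)
  have hsq : ∀ x : A ⊗[ℂ] B, induced N θ x ^ 2 ≤ induced N θ (star x * x) := fun x => by
    have h1 : induced N θ x ≤ √(induced N θ (star x * x)) := by
      refine hN.induced_le hθ (by positivity) fun z hz => Real.le_sqrt_of_sq_le ?_
      rw [← hN.star_mul_self, star_tensorAction_mul hθ, ← tensorAction_mul]
      refine (hN.mul_le _ _).trans ?_
      rw [hN.map_star]
      refine (mul_le_of_le_one_left (apply_nonneg _ _) hz).trans ?_
      exact (hN.tensorAction_le_induced hθ _ _).trans (mul_le_of_le_one_right (by positivity) hz)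
    calc induced N θ x ^ 2 ≤ √(induced N θ (star x * x)) ^ 2 := by gcongr
      _ = _ := Real.sq_sqrt (by positivity)
  have hle : ∀ x : A ⊗[ℂ] B, induced N θ x ≤ induced N θ (star x) := fun x => by
    rcases (apply_nonneg (induced N θ) x).eq_or_lt with h | h
    · rw [← h]; positivity
    · have := (hsq x).trans (hmul _ _)
      rw [sq] at this
      exact le_of_mul_le_mul_right this h
  refine ⟨hmul, fun x => le_antisymm ?_ (hsq x)⟩
  rw [sq]
  refine (hmul _ _).trans ?_
  gcongr
  simpa using hle (star x)

/-- Test on `t⋆`: `N (t t⋆) = N t * N (t⋆)`. -/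
theorem le_induced {x : A ⊗[ℂ] B} {t : C ⊗[ℂ] B} (hx : ∀ y, tensorAction B θ x y = t * y) :
    N t ≤ induced N θ x := by
  rcases (apply_nonneg N t).eq_or_lt with h | h
  · rw [← h]; positivity
  have h1 := hN.tensorAction_le_induced hθ x (star t)
  have h2 : N (t * star t) = N t * N t := by
    have := hN.star_mul_self (star t)
    rwa [star_star, hN.map_star, sq] at this
  rw [hx, h2, hN.map_star] at h1
  exact le_of_mul_le_mul_right h1 h

end Induced

end IsCStarSeminorm

end TensorAction

/-! ### The minimal norm as a C⋆-seminorm -/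

section MinSeminorm

theorem isCStarSeminorm_sSup {T : Type*} [NonUnitalRing T] [StarRing T] [Module ℂ T]
    {s : Set (Seminorm ℂ T)} (hs : BddAbove s) (h : ∀ N ∈ s, IsCStarSeminorm N) :
    IsCStarSeminorm (sSup s) := by
  have hle : ∀ N ∈ s, ∀ x, N x ≤ sSup s x := fun N hN x => le_csSup hs hN x
  have hsup : ∀ (x : T) (r : ℝ), 0 ≤ r → (∀ N ∈ s, N x ≤ r) → sSup s x ≤ r := fun x r hr hx => by
    rw [Seminorm.sSup_apply hs]
    exact Real.iSup_le (fun N => hx N N.2) hr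
  refine ⟨fun x y => ?_, fun x => le_antisymm ?_ ?_⟩
  · refine hsup _ _ (by positivity) fun N hN => ((h N hN).mul_le x y).trans ?_
    gcongr <;> exact hle N hN _
  · refine hsup _ _ (by positivity) fun N hN => ?_
    rw [(h N hN).star_mul_self]
    gcongr
    exact hle N hN _
  · have h1 : sSup s x ≤ √(sSup s (star x * x)) := by
      refine hsup _ _ (by positivity) fun N hN => Real.le_sqrt_of_sq_le ?_
      rw [← (h N hN).star_mul_self]
      exact hle N hN _
    calc sSup s x ^ 2 ≤ √(sSup s (star x * x)) ^ 2 := by gcongr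
      _ = _ := Real.sq_sqrt (by positivity)

theorem exists_forall_isCStarSeminorm_le {A B : Type*} [NonUnitalCStarAlgebra A]
    [NonUnitalCStarAlgebra B] (t : A ⊗[ℂ] B) :
    ∃ r, ∀ N : Seminorm ℂ (A ⊗[ℂ] B), IsCStarSeminorm N → N t ≤ r := by
  induction t with
  | zero => exact ⟨0, by simp⟩
  | add x y hx hy =>
    obtain ⟨r, hr⟩ := hx
    obtain ⟨s, hs⟩ := hy
    exact ⟨r + s, fun N hN => (map_add_le_add _ _ _).trans (add_le_add (hr N hN) (hs N hN))⟩
  | tmul a b => exact ⟨_, fun N hN => hN.map_tmul_le a b⟩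

/-- The minimal C⋆-norm is (the coercion of) a C⋆-seminorm. -/
theorem exists_isCStarSeminorm_eq_minNorm (A : Type u) (B : Type v) [NonUnitalCStarAlgebra A]
    [NonUnitalCStarAlgebra B] : ∃ M : Seminorm ℂ (A ⊗[ℂ] B), IsCStarSeminorm M ∧
      ∀ t, ENNReal.ofReal (M t) = minNorm t := by
  -- All C⋆-seminorms below the minimal norm are admitted; the spatial ones are among them, so the
  -- supremum is the same.
  set s : Set (Seminorm ℂ (A ⊗[ℂ] B)) := {N | IsCStarSeminorm N ∧
    ∀ t, ENNReal.ofReal (N t) ≤ minNorm t} with hs_def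
  have hs : BddAbove s := by
    rw [Seminorm.bddAbove_iff]
    choose r hr using exists_forall_isCStarSeminorm_le (A := A) (B := B)
    refine ⟨r, ?_⟩
    rintro _ ⟨N, hN, rfl⟩ t
    exact hr t N hN.1
  refine ⟨sSup s, isCStarSeminorm_sSup hs fun N hN => hN.1, fun t => le_antisymm ?_ ?_⟩
  · rcases eq_or_ne (minNorm t) ⊤ with h | h
    · rw [h]; exact le_top
    rw [ENNReal.ofReal_le_iff_le_toReal h, Seminorm.sSup_apply hs]
    exact Real.iSup_le (fun N => (ENNReal.ofReal_le_iff_le_toReal h).1 (N.2.2 t))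
      ENNReal.toReal_nonneg
  · refine minNorm_le_iff.2 fun H _ _ _ K _ _ _ π ρ => ENNReal.ofReal_le_ofReal ?_
    have : repSeminorm π ρ ∈ s :=
      ⟨isCStarSeminorm_repSeminorm π ρ, ofReal_norm_tensorRep_le_minNorm π ρ⟩
    exact le_csSup hs this t

end MinSeminorm

/-! ### Contractive projections along closed ideals -/

section ComplementedIdeal

variable {A : Type*} [NonUnitalCStarAlgebra A] {C : NonUnitalStarSubalgebra ℂ A}
  {J : Submodule ℂ A}

theorem mul_mem_of_star_mem (hCJ : ∀ x ∈ C, ∀ y ∈ J, x * y ∈ J) (hstar : ∀ x ∈ J, star x ∈ J)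
    {x y : A} (hx : x ∈ J) (hy : y ∈ C) : x * y ∈ J := by
  simpa using hstar _ (hCJ _ (star_mem hy) _ (hstar _ hx))

/-- The ⋆-algebra of all `(x, y)` with `y ∈ C` that agree modulo the ideal `J`. -/
def fiberProduct (C : NonUnitalStarSubalgebra ℂ A) (J : Submodule ℂ A)
    (hJJ : ∀ x ∈ J, ∀ y ∈ J, x * y ∈ J)
    (hCJ : ∀ x ∈ C, ∀ y ∈ J, x * y ∈ J) (hstar : ∀ x ∈ J, star x ∈ J) :
    NonUnitalStarSubalgebra ℂ (A × A) where
  carrier := {p | p.2 ∈ C ∧ p.1 - p.2 ∈ J}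
  add_mem' := by
    rintro ⟨x, y⟩ ⟨x', y'⟩ ⟨hy, hxy⟩ ⟨hy', hxy'⟩
    refine ⟨add_mem hy hy', ?_⟩
    have := add_mem hxy hxy'
    rwa [sub_add_sub_comm] at this
  zero_mem' := ⟨zero_mem C, by simp⟩
  mul_mem' := by
    rintro ⟨x, y⟩ ⟨x', y'⟩ ⟨hy, hxy⟩ ⟨hy', hxy'⟩
    refine ⟨mul_mem hy hy', ?_⟩
    have h : x * x' - y * y' = (x - y) * (x' - y') + (x - y) * y' + y * (x' - y') := by
      noncomm_ring
    change x * x' - y * y' ∈ J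
    rw [h]
    exact add_mem (add_mem (hJJ _ hxy _ hxy') (mul_mem_of_star_mem hCJ hstar hxy hy'))
      (hCJ _ hy _ hxy')
  smul_mem' := by
    rintro c ⟨x, y⟩ ⟨hy, hxy⟩
    refine ⟨SMulMemClass.smul_mem c hy, ?_⟩
    have := J.smul_mem c hxy
    rwa [smul_sub] at this
  star_mem' := by
    rintro ⟨x, y⟩ ⟨hy, hxy⟩
    refine ⟨star_mem hy, ?_⟩
    have := hstar _ hxy
    rwa [star_sub] at this

/-- If a C⋆-subalgebra `C` normalizes a closed ⋆-algebra `J` and meets it trivially, then the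
projection of `C + J` to `C` is contractive. -/
theorem norm_le_norm_add_of_disjoint (hC : IsClosed (C : Set A)) (hJ : IsClosed (J : Set A))
    (hJJ : ∀ x ∈ J, ∀ y ∈ J, x * y ∈ J) (hCJ : ∀ x ∈ C, ∀ y ∈ J, x * y ∈ J)
    (hstar : ∀ x ∈ J, star x ∈ J) (hdisj : ∀ x ∈ C, x ∈ J → x = 0) {a j : A} (ha : a ∈ C)
    (hj : j ∈ J) : ‖a‖ ≤ ‖a + j‖ := by
  suffices h : ∀ a ∈ C, IsSelfAdjoint a → ∀ x, IsSelfAdjoint x → x - a ∈ J → ‖a‖ ≤ ‖x‖ by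
    have h1 := h (star a * a) (mul_mem (star_mem ha) ha) (IsSelfAdjoint.star_mul_self a)
      (star (a + j) * (a + j)) (IsSelfAdjoint.star_mul_self _) (by
        have h2 : star (a + j) * (a + j) - star a * a =
            star a * j + star j * a + star j * j := by
          rw [star_add]; noncomm_ring
        rw [h2]
        exact add_mem (add_mem (hCJ _ (star_mem ha) _ hj)
          (mul_mem_of_star_mem hCJ hstar (hstar _ hj) ha)) (hJJ _ (hstar _ hj) _ hj))
    rw [CStarRing.norm_star_mul_self, CStarRing.norm_star_mul_self] at h1
    exact (mul_self_le_mul_self_iff (norm_nonneg _) (norm_nonneg _)).2 h1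
  intro a ha hasa x hxsa hxa
  -- Functional calculus of `(x, a)` stays in this closed ⋆-algebra, so `f x - f a ∈ J` and `f a ∈
  -- C`. The function `f` vanishes exactly on `[-‖x‖, ‖x‖]`; thus `f x = 0`, so `f a ∈ C ∩ J` is
  -- zero and the spectrum of `a` lies in that interval.
  let S := fiberProduct C J hJJ hCJ hstar
  have hS : IsClosed (S : Set (A × A)) :=
    (hC.preimage continuous_snd).inter (hJ.preimage (continuous_fst.sub continuous_snd))
  let z : S := ⟨(x, a), ha, hxa⟩
  have hz : IsSelfAdjoint z := Subtype.ext (Prod.ext hxsa hasa)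
  let f : ℝ → ℝ := fun s => max (|s| - ‖x‖) 0
  have hf : Continuous f := by fun_prop
  have hf0 : f 0 = 0 := by simp [f]
  let p₁ : S →⋆ₙₐ[ℂ] A := (NonUnitalStarAlgHom.fst ℂ A A).comp (NonUnitalStarSubalgebraClass.subtype S)
  let p₂ : S →⋆ₙₐ[ℂ] A := (NonUnitalStarAlgHom.snd ℂ A A).comp (NonUnitalStarSubalgebraClass.subtype S)
  have h₁ : p₁ (cfcₙ f z) = cfcₙ f x :=
    p₁.map_cfcₙ f z (hf.continuousOn) hf0 (continuous_fst.comp continuous_subtype_val) hz hxsa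
  have h₂ : p₂ (cfcₙ f z) = cfcₙ f a :=
    p₂.map_cfcₙ f z (hf.continuousOn) hf0 (continuous_snd.comp continuous_subtype_val) hz hasa
  have hx0 : cfcₙ f x = 0 := by
    rw [← norm_le_zero_iff]
    refine norm_cfcₙ_le fun s hs => ?_
    have hs' : ‖s‖ ≤ ‖x‖ := by
      simpa only [cfcₙ_id ℝ x] using! norm_apply_le_norm_cfcₙ (id : ℝ → ℝ) x hs
    rw [Real.norm_eq_abs] at hs'
    simp [f, hs']
  have ha0 : cfcₙ f a = 0 := by
    obtain ⟨hc, hcj⟩ := (cfcₙ f z).2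
    change p₂ (cfcₙ f z) ∈ C at hc
    change p₁ (cfcₙ f z) - p₂ (cfcₙ f z) ∈ J at hcj
    rw [h₂] at hc
    rw [h₁, h₂, hx0, zero_sub] at hcj
    exact hdisj _ hc (by simpa using J.neg_mem hcj)
  rw [← cfcₙ_id ℝ a]
  refine norm_cfcₙ_le fun s hs => ?_
  have := norm_apply_le_norm_cfcₙ f a hs
  rw [ha0, norm_zero, norm_le_zero_iff] at this
  have h3 := le_max_left (|s| - ‖x‖) 0
  change _ ≤ f s at h3
  rw [this] at h3
  simpa using h3

/-- The contractive projection bounds `(c, j) ↦ c + j` below, with constant `2` because `‖j‖ ≤ ‖c +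
j‖ + ‖c‖`. -/
theorem isClosed_sup_of_disjoint (hC : IsClosed (C : Set A)) (hJ : IsClosed (J : Set A))
    (hJJ : ∀ x ∈ J, ∀ y ∈ J, x * y ∈ J) (hCJ : ∀ x ∈ C, ∀ y ∈ J, x * y ∈ J)
    (hstar : ∀ x ∈ J, star x ∈ J) (hdisj : ∀ x ∈ C, x ∈ J → x = 0) :
    IsClosed ((C.toNonUnitalSubalgebra.toSubmodule ⊔ J : Submodule ℂ A) : Set A) := by
  have : CompleteSpace C.toNonUnitalSubalgebra.toSubmodule :=
    (IsClosed.completeSpace_coe : CompleteSpace (C : Set A))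
  have : CompleteSpace J := hJ.completeSpace_coe
  let g : C.toNonUnitalSubalgebra.toSubmodule × J →L[ℂ] A :=
    (Submodule.subtypeL _).coprod (Submodule.subtypeL J)
  have hg : AntilipschitzWith 2 g := by
    refine AddMonoidHomClass.antilipschitz_of_bound g fun p => ?_
    have h1 : ‖(p.1 : A)‖ ≤ ‖(p.1 : A) + p.2‖ :=
      norm_le_norm_add_of_disjoint hC hJ hJJ hCJ hstar hdisj p.1.2 p.2.2
    have h2 : ‖(p.2 : A)‖ ≤ ‖(p.1 : A) + p.2‖ + ‖(p.1 : A)‖ := by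
      simpa using norm_sub_le ((p.1 : A) + p.2) p.1
    change max ‖(p.1 : A)‖ ‖(p.2 : A)‖ ≤ 2 * ‖(p.1 : A) + p.2‖
    refine max_le ?_ ?_ <;> linarith [norm_nonneg ((p.1 : A) + p.2)]
  have hr := hg.isClosed_range g.uniformContinuous
  convert hr using 1
  ext x
  simp [g, Submodule.mem_sup]

end ComplementedIdeal

/-! ### Finite partial sums of the grading -/

section Grading

variable {L A : Type*} [NonUnitalCStarAlgebra A]
  {𝒜 : L → NonUnitalStarSubalgebra ℂ A}

/-- The sum of the components with index in `s`. -/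
def sumOn (𝒜 : L → NonUnitalStarSubalgebra ℂ A) (s : Set L) : Submodule ℂ A :=
  ⨆ i ∈ s, (𝒜 i).toNonUnitalSubalgebra.toSubmodule

theorem mem_sumOn {s : Set L} {i : L} (hi : i ∈ s) {a : A} (ha : a ∈ 𝒜 i) : a ∈ sumOn 𝒜 s :=
  Submodule.mem_iSup_of_mem i (Submodule.mem_iSup_of_mem hi ha)

theorem sumOn_le {s : Set L} {J : Submodule ℂ A} (h : ∀ i ∈ s, ∀ a ∈ 𝒜 i, a ∈ J) :
    sumOn 𝒜 s ≤ J :=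
  iSup₂_le fun i hi a ha => h i hi a ha

theorem sumOn_mono {s t : Set L} (h : s ⊆ t) : sumOn 𝒜 s ≤ sumOn 𝒜 t :=
  sumOn_le fun _ hi _ ha => mem_sumOn (h hi) ha

theorem sumOn_insert (m : L) (s : Set L) :
    sumOn 𝒜 (insert m s) = (𝒜 m).toNonUnitalSubalgebra.toSubmodule ⊔ sumOn 𝒜 s :=
  iSup_insert

theorem star_mem_sumOn {s : Set L} {x : A} (hx : x ∈ sumOn 𝒜 s) : star x ∈ sumOn 𝒜 s := by
  have h : sumOn 𝒜 s ≤ (sumOn 𝒜 s).comap ((starLinearEquiv ℂ : A ≃ₗ⋆[ℂ] A) : A →ₗ⋆[ℂ] A) :=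
    sumOn_le fun i hi a ha => mem_sumOn hi (star_mem ha)
  exact h hx

variable [SemilatticeInf L]

theorem mul_mem_sumOn (h𝒜 : IsSemilatticeGrading 𝒜) {s t r : Set L}
    (h : ∀ i ∈ s, ∀ j ∈ t, i ⊓ j ∈ r) {x y : A} (hx : x ∈ sumOn 𝒜 s) (hy : y ∈ sumOn 𝒜 t) :
    x * y ∈ sumOn 𝒜 r := by
  have h1 : ∀ i ∈ s, ∀ a ∈ 𝒜 i, a * y ∈ sumOn 𝒜 r := fun i hi a ha => by
    have : sumOn 𝒜 t ≤ (sumOn 𝒜 r).comap (LinearMap.mulLeft ℂ a) :=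
      sumOn_le fun j hj b hb => mem_sumOn (h i hi j hj) (h𝒜.mul_mem i j a ha b hb)
    exact this hy
  have : sumOn 𝒜 s ≤ (sumOn 𝒜 r).comap (LinearMap.mulRight ℂ y) := sumOn_le h1
  exact this hx

theorem eq_zero_of_mem_sumOn (h𝒜 : IsSemilatticeGrading 𝒜) {m : L} {s : Set L} (hm : m ∉ s)
    {x : A} (hx : x ∈ 𝒜 m) (hxs : x ∈ sumOn 𝒜 s) : x = 0 := by
  refine Submodule.disjoint_def.1 (h𝒜.independent m) x hx ?_
  have : sumOn 𝒜 s ≤ ⨆ j, ⨆ _ : j ≠ m, (𝒜 j).toNonUnitalSubalgebra.toSubmodule :=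
    sumOn_mono (t := {j | j ≠ m}) fun j hj => by rintro rfl; exact hm hj
  exact this hxs

/-- Induction on the cardinality, removing a maximal `m`: if `i ⊓ j = m` then `m ≤ i`, so `i = m` by
maximality. Hence the remaining components sum to an ideal, and their sum with `𝒜 m` is closed. -/
theorem isClosed_sumOn (h𝒜 : IsSemilatticeGrading 𝒜) (hc : ∀ i, IsClosed (𝒜 i : Set A))
    (F : Finset L) (hF : InfClosed (F : Set L)) : IsClosed (sumOn 𝒜 (F : Set L) : Set A) := by
  classical
  induction hn : F.card generalizing F with
  | zero =>
    rw [Finset.card_eq_zero] at hn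
    simp [hn, sumOn]
  | succ n ih =>
    obtain ⟨m, hm⟩ := F.exists_maximal (Finset.card_pos.1 (by omega))
    have hm' : ∀ i ∈ F.erase m, ∀ j ∈ F, i ⊓ j ∈ F.erase m := fun i hi j hj => by
      have hi' := Finset.mem_erase.1 hi
      refine Finset.mem_erase.2 ⟨fun h => hi'.1 ?_, hF hi'.2 hj⟩
      exact (hm.eq_of_le hi'.2 (h ▸ inf_le_left)).symm
    have hG : InfClosed (F.erase m : Set L) := fun i hi j hj =>
      hm' i hi j (Finset.mem_of_mem_erase hj)
    have hcl := ih (F.erase m) hG (by rw [Finset.card_erase_of_mem hm.prop, hn]; rfl)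
    have hins : (F : Set L) = insert m (F.erase m : Set L) := by
      rw [← Finset.coe_insert, Finset.insert_erase hm.prop]
    rw [hins, sumOn_insert]
    refine isClosed_sup_of_disjoint (hc m) hcl
      (fun x hx y hy => mul_mem_sumOn h𝒜 (fun i hi j hj => hG hi hj) hx hy)
      (fun x hx y hy => ?_) (fun x hx => star_mem_sumOn hx)
      (fun x hx => eq_zero_of_mem_sumOn h𝒜 (by simp) hx)
    refine mul_mem_sumOn h𝒜 (s := {m}) (fun i hi j hj => ?_) (mem_sumOn (Set.mem_singleton m) hx) hy
    rw [Set.mem_singleton_iff.1 hi, inf_comm]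
    exact hm' j hj m hm.prop

theorem exists_infClosed_finset {s : Set L} (hs : InfClosed s) {G : Finset L}
    (hG : (G : Set L) ⊆ s) :
    ∃ F : Finset L, (F : Set L) ⊆ s ∧ InfClosed (F : Set L) ∧ (G : Set L) ⊆ F := by
  refine ⟨G.finite_toSet.infClosure.toFinset, ?_⟩
  rw [Set.Finite.coe_toFinset]
  exact ⟨infClosure_min hG hs, infClosed_infClosure, subset_infClosure⟩

theorem exists_finset_mem_sumOn {s : Set L} (hs : InfClosed s) {x : A} (hx : x ∈ sumOn 𝒜 s) :
    ∃ F : Finset L, (F : Set L) ⊆ s ∧ InfClosed (F : Set L) ∧ x ∈ sumOn 𝒜 (F : Set L) := by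
  classical
  rw [sumOn, iSup_subtype'] at hx
  induction hx using Submodule.iSup_induction' with
  | mem i x hx =>
    obtain ⟨F, h1, h2, h3⟩ := exists_infClosed_finset hs (G := {i.1}) (by simp)
    exact ⟨F, h1, h2, mem_sumOn (h3 (by simp)) hx⟩
  | zero => exact ⟨∅, by simp, by simp, zero_mem _⟩
  | add x y _ _ hx hy =>
    obtain ⟨F, h1, -, h3⟩ := hx
    obtain ⟨F', h1', -, h3'⟩ := hy
    obtain ⟨G, g1, g2, g3⟩ := exists_infClosed_finset hs (G := F ∪ F') (by simp [h1, h1'])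
    rw [Finset.coe_union, Set.union_subset_iff] at g3
    exact ⟨G, g1, g2, add_mem (sumOn_mono g3.1 h3) (sumOn_mono g3.2 h3')⟩

/-- The projection onto a component along the sum of the strictly smaller ones is contractive. -/
theorem norm_le_norm_add_of_mem_sumOn_Iio (h𝒜 : IsSemilatticeGrading 𝒜)
    (hc : ∀ i, IsClosed (𝒜 i : Set A)) {m : L} {a j : A} (ha : a ∈ 𝒜 m)
    (hj : j ∈ sumOn 𝒜 (Set.Iio m)) : ‖a‖ ≤ ‖a + j‖ := by
  have hIio : InfClosed (Set.Iio m) := fun i hi j _ => inf_le_left.trans_lt hi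
  -- The sum over all of `Set.Iio m` need not be closed, but `j` already lies in a finite
  -- meet-closed part.
  obtain ⟨F, h1, h2, h3⟩ := exists_finset_mem_sumOn hIio hj
  refine norm_le_norm_add_of_disjoint (hc m) (isClosed_sumOn h𝒜 hc F h2)
    (fun x hx y hy => mul_mem_sumOn h𝒜 (fun i hi j hj => h2 hi hj) hx hy) (fun x hx y hy => ?_)
    (fun x hx => star_mem_sumOn hx)
    (fun x hx => eq_zero_of_mem_sumOn h𝒜 (fun hm => lt_irrefl m (h1 hm)) hx) ha h3
  refine mul_mem_sumOn h𝒜 (s := {m}) (fun i hi j hj => ?_) (mem_sumOn (Set.mem_singleton m) hx) hy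
  rw [Set.mem_singleton_iff.1 hi, inf_eq_right.2 (h1 hj).le]
  exact hj

end Grading

/-! ### Extension of representations through an action -/

section ExtendRep

variable {A C H : Type*} [NonUnitalCStarAlgebra A] [NonUnitalCStarAlgebra C]
  [NormedAddCommGroup H] [InnerProductSpace ℂ H] [CompleteSpace H]

/-- The evaluation `c ⊗ h ↦ π c h` of a representation. -/
def repEval (π : C →⋆ₙₐ[ℂ] (H →L[ℂ] H)) : C ⊗[ℂ] H →ₗ[ℂ] H :=
  TensorProduct.lift (ContinuousLinearMap.coeLM ℂ ∘ₗ (π : C →ₗ[ℂ] (H →L[ℂ] H)))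

@[simp] theorem repEval_tmul (π : C →⋆ₙₐ[ℂ] (H →L[ℂ] H)) (c : C) (h : H) :
    repEval π (c ⊗ₜ h) = π c h := rfl

variable {θ : A →ₙₐ[ℂ] Module.End ℂ C} (hθ : ∀ a x y, star (θ a x) * y = star x * θ (star a) y)
  (π : C →⋆ₙₐ[ℂ] (H →L[ℂ] H))

theorem inner_rep_rep (c c' : C) (h h' : H) :
    inner ℂ (π c h) (π c' h') = inner ℂ h (π (star c * c') h') := by
  rw [map_mul, map_star, ContinuousLinearMap.star_eq_adjoint, mul_apply_eq_comp,
    ContinuousLinearMap.adjoint_inner_right]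

include hθ in
theorem inner_repEval_actLeft (a : A) (v w : C ⊗[ℂ] H) :
    inner ℂ (repEval π (actLeft H θ a v)) (repEval π w) =
      inner ℂ (repEval π v) (repEval π (actLeft H θ (star a) w)) := by
  induction v with
  | zero => simp
  | add v₁ v₂ h₁ h₂ => simp only [map_add, inner_add_left, h₁, h₂]
  | tmul c h =>
    induction w with
    | zero => simp
    | add w₁ w₂ h₁ h₂ => simp only [map_add, inner_add_right, h₁, h₂]
    | tmul c' h' => simp [inner_rep_rep, hθ]

include hθ in
-- The action is adjointable for the inner product pulled back along `repEval π`. The bound lets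
-- each operator descend to the range of `repEval π`, although `θ` is not assumed continuous.
theorem norm_repEval_actLeft_le (a : A) (v : C ⊗[ℂ] H) :
    ‖repEval π (actLeft H θ a v)‖ ≤ 2 * ‖a‖ * ‖repEval π v‖ := by
  refine seminorm_action_le ((normSeminorm ℂ H).comp (repEval π))
    ((innerₛₗ ℂ ∘ₛₗ repEval π).compl₂ (repEval π)) (fun z : ℂ => ‖z‖) (fun v => ?_) (actLeft H θ)
    (fun a v w => ?_) a v
  · simp [inner_self_eq_norm_sq_to_K]
  · simpa using inner_repEval_actLeft hθ π a v w

/-- The dense decomposition of `H` into the essential subspace of `π` and its complement. -/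
def essentialSum : (C ⊗[ℂ] H) × (LinearMap.range (repEval π))ᗮ →ₗ[ℂ] H :=
  (repEval π).coprod (LinearMap.range (repEval π))ᗮ.subtype

theorem essentialSum_apply (p : (C ⊗[ℂ] H) × (LinearMap.range (repEval π))ᗮ) :
    essentialSum π p = repEval π p.1 + p.2 := rfl

theorem denseRange_essentialSum : DenseRange (essentialSum π) := by
  have h : LinearMap.range (essentialSum π) =
      LinearMap.range (repEval π) ⊔ (LinearMap.range (repEval π))ᗮ := by
    rw [essentialSum, LinearMap.range_coprod, Submodule.range_subtype]
  have h2 : (LinearMap.range (essentialSum π)).topologicalClosure = ⊤ := by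
    rw [Submodule.topologicalClosure_eq_top_iff, h, ← Submodule.inf_orthogonal,
      Submodule.inf_orthogonal_eq_bot]
  exact Submodule.dense_iff_topologicalClosure_eq_top.2 h2

theorem inner_repEval_orthogonal (v : C ⊗[ℂ] H) (k : (LinearMap.range (repEval π))ᗮ) :
    inner ℂ (repEval π v) (k : H) = 0 :=
  Submodule.inner_right_of_mem_orthogonal (LinearMap.mem_range_self _ v) k.2

theorem inner_orthogonal_repEval (v : C ⊗[ℂ] H) (k : (LinearMap.range (repEval π))ᗮ) :
    inner ℂ (k : H) (repEval π v) = 0 :=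
  Submodule.inner_left_of_mem_orthogonal (LinearMap.mem_range_self _ v) k.2

theorem norm_repEval_le (p : (C ⊗[ℂ] H) × (LinearMap.range (repEval π))ᗮ) :
    ‖repEval π p.1‖ ≤ ‖essentialSum π p‖ := by
  have := norm_add_sq_eq_norm_sq_add_norm_sq_of_inner_eq_zero _ _
    (inner_repEval_orthogonal π p.1 p.2)
  rw [← essentialSum_apply] at this
  nlinarith [norm_nonneg (repEval π p.1), norm_nonneg (essentialSum π p), norm_nonneg (p.2 : H)]

/-- The operator by which `a` acts through an action `θ` and a representation `π`. -/
def extendRepFun (θ : A →ₙₐ[ℂ] Module.End ℂ C) (π : C →⋆ₙₐ[ℂ] (H →L[ℂ] H)) (a : A) : H →L[ℂ] H :=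
  (repEval π ∘ₗ actLeft H θ a ∘ₗ LinearMap.fst ℂ _ _).extendOfNorm (essentialSum π)

include hθ in
theorem extendRepFun_essentialSum (a : A) (p : (C ⊗[ℂ] H) × (LinearMap.range (repEval π))ᗮ) :
    extendRepFun θ π a (essentialSum π p) = repEval π (actLeft H θ a p.1) := by
  refine LinearMap.extendOfNorm_eq (denseRange_essentialSum π) ⟨2 * ‖a‖, fun p => ?_⟩ p
  refine (norm_repEval_actLeft_le hθ π a p.1).trans ?_
  gcongr
  exact norm_repEval_le π p

theorem ext_essentialSum {f g : H →L[ℂ] H}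
    (h : ∀ p, f (essentialSum π p) = g (essentialSum π p)) : f = g :=
  ContinuousLinearMap.coeFn_injective <|
    (denseRange_essentialSum π).equalizer f.continuous g.continuous (funext h)

/-- The representation of `A` that a representation `π` of `C` induces through an action of `A` on
`C`; it vanishes on the complement of the essential subspace of `π`. -/
def extendRep : A →⋆ₙₐ[ℂ] (H →L[ℂ] H) where
  toFun := extendRepFun θ π
  map_smul' c a := ext_essentialSum π fun p => by
    simp [extendRepFun_essentialSum hθ]
  map_zero' := ext_essentialSum π fun p => by
    simp [extendRepFun_essentialSum hθ]
  map_add' a b := ext_essentialSum π fun p => by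
    simp [extendRepFun_essentialSum hθ]
  map_mul' a b := ext_essentialSum π fun p => by
    rw [mul_apply_eq_comp, extendRepFun_essentialSum hθ, extendRepFun_essentialSum hθ, map_mul,
      Module.End.mul_apply]
    have := extendRepFun_essentialSum hθ π a (actLeft H θ b p.1, 0)
    rw [essentialSum_apply, ZeroMemClass.coe_zero, add_zero] at this
    exact this.symm
  map_star' a := by
    rw [ContinuousLinearMap.star_eq_adjoint, ContinuousLinearMap.eq_adjoint_iff]
    intro x y
    refine (denseRange_essentialSum π).induction_on₂ (p := fun x y =>
      inner ℂ (extendRepFun θ π (star a) x) y = inner ℂ x (extendRepFun θ π a y)) ?_ ?_ x y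
    · exact isClosed_eq (by fun_prop) (by fun_prop)
    · intro p q
      rw [extendRepFun_essentialSum hθ, extendRepFun_essentialSum hθ, essentialSum_apply,
        essentialSum_apply, inner_add_left, inner_add_right, inner_repEval_orthogonal,
        inner_orthogonal_repEval, add_zero, add_zero, inner_repEval_actLeft hθ, star_star]

theorem extendRep_essentialSum (a : A) (p : (C ⊗[ℂ] H) × (LinearMap.range (repEval π))ᗮ) :
    extendRep hθ π a (essentialSum π p) = repEval π (actLeft H θ a p.1) :=
  extendRepFun_essentialSum hθ π a p

theorem extendRep_eq_zero {a : A} (ha : θ a = 0) : extendRep hθ π a = 0 :=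
  ext_essentialSum π fun p => by
    have : actLeft H θ a = 0 := by
      change LinearMap.rTensor H (θ a) = 0
      rw [ha, LinearMap.rTensor_zero]
    rw [extendRep_essentialSum, this]
    simp

/-- On the essential subspace this is associativity. On its complement `π c` vanishes too, since `‖π
c k‖² = ⟪k, π (c⋆ c) k⟫ = 0`; so `π` may be degenerate. -/
theorem extendRep_eq {a : A} {c : C} (ha : ∀ x, θ a x = c * x) : extendRep hθ π a = π c := by
  refine ext_essentialSum π fun p => ?_
  have h1 : ∀ v, repEval π (actLeft H θ a v) = π c (repEval π v) := fun v => by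
    induction v with
    | zero => simp
    | add v₁ v₂ h₁ h₂ => simp only [map_add, h₁, h₂]
    | tmul c' h => simp [ha]
  have h2 : π c (p.2 : H) = 0 := by
    rw [← inner_self_eq_zero (𝕜 := ℂ), inner_rep_rep, ← repEval_tmul, inner_orthogonal_repEval]
  rw [extendRep_essentialSum, h1, essentialSum_apply, map_add, h2, add_zero]

end ExtendRep

/-! ### The multiplier action on a component -/

section ComponentAction

variable {L A : Type*} [SemilatticeInf L] [NonUnitalCStarAlgebra A]
  {𝒜 : L → NonUnitalStarSubalgebra ℂ A} {m : L}

variable (𝒜 m) in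
/-- The dense decomposition into the components above `m` and the other ones. -/
def filterSum : sumOn 𝒜 (Set.Ici m) × sumOn 𝒜 (Set.Ici m)ᶜ →ₗ[ℂ] A :=
  (Submodule.subtype _).coprod (Submodule.subtype _)

theorem filterSum_apply (p : sumOn 𝒜 (Set.Ici m) × sumOn 𝒜 (Set.Ici m)ᶜ) :
    filterSum 𝒜 m p = p.1 + p.2 := rfl

theorem denseRange_filterSum (h𝒜 : IsSemilatticeGrading 𝒜) : DenseRange (filterSum 𝒜 m) := by
  refine h𝒜.total.mono ?_
  have : (⨆ i, (𝒜 i).toNonUnitalSubalgebra.toSubmodule) ≤ LinearMap.range (filterSum 𝒜 m) := by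
    refine iSup_le fun i a ha => ?_
    by_cases hi : i ∈ Set.Ici m
    · exact ⟨(⟨a, mem_sumOn hi ha⟩, 0), by simp [filterSum_apply]⟩
    · exact ⟨(0, ⟨a, mem_sumOn hi ha⟩), by simp [filterSum_apply]⟩
  exact this

theorem mul_mem_component (h𝒜 : IsSemilatticeGrading 𝒜) {v x : A} (hv : v ∈ sumOn 𝒜 (Set.Ici m))
    (hx : x ∈ 𝒜 m) : v * x ∈ 𝒜 m := by
  have h1 : v * x ∈ sumOn 𝒜 {m} := mul_mem_sumOn h𝒜
    (fun i hi j hj => by rw [Set.mem_singleton_iff.1 hj]; exact inf_eq_right.2 hi) hv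
    (mem_sumOn (Set.mem_singleton m) hx)
  rw [sumOn, iSup_singleton] at h1
  exact h1

/-- For `x` in the `m`-th component, the continuous extension of the map that sends the sum of
an element `v` of components above `m` and an element of other components to `v x`. -/
def filterMul (𝒜 : L → NonUnitalStarSubalgebra ℂ A) (m : L) (x : A) : A →L[ℂ] A :=
  (LinearMap.mulRight ℂ x ∘ₗ Submodule.subtype _ ∘ₗ LinearMap.fst ℂ _ _).extendOfNorm
    (filterSum 𝒜 m)

variable (h𝒜 : IsSemilatticeGrading 𝒜) (hc : ∀ i, IsClosed (𝒜 i : Set A))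

include h𝒜 hc

/-- For `w` in components not above `m`, the product `w * x` lies strictly below `m`. Thus `v * x`
is the projection of `(v + w) * x` onto the component, and contractivity gives the bound `‖x‖`
needed to extend. -/
theorem filterMul_filterSum {x : A} (hx : x ∈ 𝒜 m)
    (p : sumOn 𝒜 (Set.Ici m) × sumOn 𝒜 (Set.Ici m)ᶜ) :
    filterMul 𝒜 m x (filterSum 𝒜 m p) = p.1 * x := by
  refine LinearMap.extendOfNorm_eq (denseRange_filterSum h𝒜) ⟨‖x‖, fun p => ?_⟩ p
  have h1 : (p.2 : A) * x ∈ sumOn 𝒜 (Set.Iio m) := mul_mem_sumOn h𝒜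
    (fun i hi j hj => by rw [Set.mem_singleton_iff.1 hj]; exact inf_lt_right.2 hi) p.2.2
    (mem_sumOn (Set.mem_singleton m) hx)
  calc ‖(p.1 : A) * x‖ ≤ ‖(p.1 : A) * x + p.2 * x‖ :=
        norm_le_norm_add_of_mem_sumOn_Iio h𝒜 hc (mul_mem_component h𝒜 p.1.2 hx) h1
    _ = ‖filterSum 𝒜 m p * x‖ := by rw [filterSum_apply, add_mul]
    _ ≤ ‖filterSum 𝒜 m p‖ * ‖x‖ := norm_mul_le _ _
    _ = _ := mul_comm _ _

theorem filterMul_of_mem {x : A} (hx : x ∈ 𝒜 m) {a : A} (ha : a ∈ sumOn 𝒜 (Set.Ici m)) :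
    filterMul 𝒜 m x a = a * x := by
  simpa [filterSum_apply] using filterMul_filterSum h𝒜 hc hx (⟨a, ha⟩, 0)

theorem filterMul_of_mem_compl {x : A} (hx : x ∈ 𝒜 m) {a : A} (ha : a ∈ sumOn 𝒜 (Set.Ici m)ᶜ) :
    filterMul 𝒜 m x a = 0 := by
  simpa [filterSum_apply] using filterMul_filterSum h𝒜 hc hx (0, ⟨a, ha⟩)

theorem filterMul_mem {x : A} (hx : x ∈ 𝒜 m) (a : A) : filterMul 𝒜 m x a ∈ 𝒜 m := by
  refine (denseRange_filterSum (m := m) h𝒜).induction_on (p := fun a => filterMul 𝒜 m x a ∈ 𝒜 m) a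
    ((hc m).preimage (filterMul 𝒜 m x).continuous) fun p => ?_
  rw [filterMul_filterSum h𝒜 hc hx]
  exact mul_mem_component h𝒜 p.1.2 hx

theorem filterMul_add {x y : A} (hx : x ∈ 𝒜 m) (hy : y ∈ 𝒜 m) (a : A) :
    filterMul 𝒜 m (x + y) a = filterMul 𝒜 m x a + filterMul 𝒜 m y a := by
  refine (denseRange_filterSum (m := m) h𝒜).induction_on (p := fun a => filterMul 𝒜 m (x + y) a =
    filterMul 𝒜 m x a + filterMul 𝒜 m y a) a (isClosed_eq (by fun_prop) (by fun_prop)) fun p => ?_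
  rw [filterMul_filterSum h𝒜 hc hx, filterMul_filterSum h𝒜 hc hy,
    filterMul_filterSum h𝒜 hc (add_mem hx hy), mul_add]

theorem filterMul_smul (c : ℂ) {x : A} (hx : x ∈ 𝒜 m) (a : A) :
    filterMul 𝒜 m (c • x) a = c • filterMul 𝒜 m x a := by
  refine (denseRange_filterSum (m := m) h𝒜).induction_on (p := fun a => filterMul 𝒜 m (c • x) a =
    c • filterMul 𝒜 m x a) a (isClosed_eq (by fun_prop) (by fun_prop)) fun p => ?_
  rw [filterMul_filterSum h𝒜 hc hx, filterMul_filterSum h𝒜 hc (SMulMemClass.smul_mem c hx),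
    mul_smul_comm]

/-- The indices above `m` are closed under meets and the other ones absorb meets, so only the
product of the two upper parts survives. -/
theorem filterMul_mul {x : A} (hx : x ∈ 𝒜 m) (a b : A) :
    filterMul 𝒜 m x (a * b) = filterMul 𝒜 m (filterMul 𝒜 m x b) a := by
  refine (denseRange_filterSum (m := m) h𝒜).induction_on (p := fun a => filterMul 𝒜 m x (a * b) =
    filterMul 𝒜 m (filterMul 𝒜 m x b) a) a (isClosed_eq (by fun_prop) (by fun_prop)) fun p => ?_
  rw [filterMul_filterSum h𝒜 hc (filterMul_mem h𝒜 hc hx b)]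
  refine (denseRange_filterSum (m := m) h𝒜).induction_on (p := fun b => filterMul 𝒜 m x
    (filterSum 𝒜 m p * b) = p.1 * filterMul 𝒜 m x b) b
    (isClosed_eq (by fun_prop) (by fun_prop)) fun q => ?_
  have h1 : (p.1 * q.1 : A) ∈ sumOn 𝒜 (Set.Ici m) :=
    mul_mem_sumOn h𝒜 (fun i hi j hj => le_inf hi hj) p.1.2 q.1.2
  have h2 : (p.1 * q.2 : A) ∈ sumOn 𝒜 (Set.Ici m)ᶜ :=
    mul_mem_sumOn h𝒜 (s := Set.Ici m) (t := (Set.Ici m)ᶜ) (r := (Set.Ici m)ᶜ)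
      (fun i _ j hj h => hj (le_trans h inf_le_right)) p.1.2 q.2.2
  have h3 : (p.2 * filterSum 𝒜 m q : A) ∈ sumOn 𝒜 (Set.Ici m)ᶜ := by
    refine mul_mem_sumOn h𝒜 (s := (Set.Ici m)ᶜ) (t := Set.univ) (r := (Set.Ici m)ᶜ)
      (fun i hi j _ h => hi (le_trans h inf_le_left)) p.2.2 ?_
    exact add_mem (sumOn_mono (Set.subset_univ _) q.1.2) (sumOn_mono (Set.subset_univ _) q.2.2)
  rw [filterMul_filterSum h𝒜 hc hx, filterSum_apply p, add_mul, map_add,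
    filterMul_of_mem_compl h𝒜 hc hx h3, add_zero, filterSum_apply, mul_add, map_add,
    filterMul_of_mem h𝒜 hc hx h1, filterMul_of_mem_compl h𝒜 hc hx h2, add_zero, mul_assoc]

theorem star_filterMul_mul {x y : A} (hx : x ∈ 𝒜 m) (hy : y ∈ 𝒜 m) (a : A) :
    star (filterMul 𝒜 m x a) * y = star x * filterMul 𝒜 m y (star a) := by
  refine (denseRange_filterSum (m := m) h𝒜).induction_on (p := fun a => star (filterMul 𝒜 m x a) * y =
    star x * filterMul 𝒜 m y (star a)) a (isClosed_eq (by fun_prop) (by fun_prop)) fun p => ?_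
  rw [filterMul_filterSum h𝒜 hc hx, filterSum_apply, star_add, map_add,
    filterMul_of_mem h𝒜 hc hy (star_mem_sumOn p.1.2),
    filterMul_of_mem_compl h𝒜 hc hy (star_mem_sumOn p.2.2), add_zero, star_mul, mul_assoc]

omit hc in
/-- The whole algebra acts by multipliers on each component: the components that are not above `m`
act on the `m`-th one by zero, the other ones by multiplication. -/
theorem exists_componentAction [hc : ∀ i, IsClosed (𝒜 i : Set A)] (m : L) :
    ∃ θ : A →ₙₐ[ℂ] Module.End ℂ (𝒜 m), (∀ a x y, star (θ a x) * y = star x * θ (star a) y) ∧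
      (∀ c x : 𝒜 m, θ c x = c * x) ∧ ∀ i, ¬ m ≤ i → ∀ a ∈ 𝒜 i, θ a = 0 := by
  let θ : A →ₙₐ[ℂ] Module.End ℂ (𝒜 m) :=
    { toFun := fun a =>
        { toFun := fun x => ⟨filterMul 𝒜 m x a, filterMul_mem h𝒜 hc x.2 a⟩
          map_add' := fun x y => Subtype.ext (filterMul_add h𝒜 hc x.2 y.2 a)
          map_smul' := fun c x => Subtype.ext (filterMul_smul h𝒜 hc c x.2 a) }
      map_smul' := fun c a => LinearMap.ext fun x => Subtype.ext (map_smul _ c a)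
      map_zero' := LinearMap.ext fun x => Subtype.ext (map_zero _)
      map_add' := fun a b => LinearMap.ext fun x => Subtype.ext (map_add _ a b)
      map_mul' := fun a b => LinearMap.ext fun x => Subtype.ext (filterMul_mul h𝒜 hc x.2 a b) }
  refine ⟨θ, fun a x y => Subtype.ext (star_filterMul_mul h𝒜 hc x.2 y.2 a), fun c x =>
    Subtype.ext (filterMul_of_mem h𝒜 hc x.2 (mem_sumOn Set.self_mem_Ici c.2)), fun i hi a ha =>
    LinearMap.ext fun x => Subtype.ext (filterMul_of_mem_compl h𝒜 hc x.2 (mem_sumOn hi ha))⟩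

end ComponentAction

/-! ### Nuclearity passes to components -/

section NuclearComponents

variable {L : Type w} [SemilatticeInf L] {A : Type u} [NonUnitalCStarAlgebra A]
  {𝒜 : L → NonUnitalStarSubalgebra ℂ A} [∀ i, IsClosed (𝒜 i : Set A)]

/-- The inclusion of a component. -/
abbrev componentHom (𝒜 : L → NonUnitalStarSubalgebra ℂ A) (i : L) : 𝒜 i →⋆ₙₐ[ℂ] A :=
  NonUnitalStarSubalgebraClass.subtype (𝒜 i)

/-- The component acts on itself by multiplication, so the induced seminorm on `A ⊗ B` dominates
`N`; nuclearity of `A` applies to it. -/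
theorem isNuclear_component (h𝒜 : IsSemilatticeGrading 𝒜) (hA : IsNuclear.{u, v} A) (m : L) :
    IsNuclear.{u, v} (𝒜 m) := by
  obtain ⟨θ, hθ, hmul, -⟩ := exists_componentAction h𝒜 m
  rw [isNuclear_iff] at hA ⊢
  intro B _ N hN t
  have hact : ∀ y, tensorAction B θ (tensorMapLeft B (componentHom 𝒜 m) t) y = t * y := by
    intro y
    induction t with
    | zero => simp
    | add t₁ t₂ h₁ h₂ => simp only [map_add, LinearMap.add_apply, h₁, h₂, add_mul]
    | tmul c b =>
      induction y with
      | zero => simp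
      | add y₁ y₂ h₁ h₂ => simp only [map_add, h₁, h₂, mul_add]
      | tmul c' b' => simp [hmul]
  calc ENNReal.ofReal (N t)
      ≤ ENNReal.ofReal (IsCStarSeminorm.induced N θ (tensorMapLeft B (componentHom 𝒜 m) t)) :=
        ENNReal.ofReal_le_ofReal (hN.le_induced hθ hact)
    _ ≤ minNorm (tensorMapLeft B (componentHom 𝒜 m) t) :=
        hA B _ (hN.isCStarSeminorm_induced hθ) _
    _ ≤ minNorm t := minNorm_tensorMapLeft_le _ _

end NuclearComponents

/-! ### Nuclearity passes from components to the algebra -/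

section NuclearSum

variable {L : Type w} {A : Type u} [NonUnitalCStarAlgebra A]
  {𝒜 : L → NonUnitalStarSubalgebra ℂ A} {B : Type v} [NonUnitalCStarAlgebra B]

/-- The part of the algebraic tensor product that comes from the components with index in `s`. -/
def tensorOn (𝒜 : L → NonUnitalStarSubalgebra ℂ A) (B : Type v) [NonUnitalCStarAlgebra B]
    (s : Set L) : Submodule ℂ (A ⊗[ℂ] B) :=
  Submodule.span ℂ {t | ∃ i ∈ s, ∃ a ∈ 𝒜 i, ∃ b : B, a ⊗ₜ b = t}

theorem tmul_mem_tensorOn {s : Set L} {i : L} (hi : i ∈ s) {a : A} (ha : a ∈ 𝒜 i) (b : B) :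
    a ⊗ₜ b ∈ tensorOn 𝒜 B s :=
  Submodule.subset_span ⟨i, hi, a, ha, b, rfl⟩

theorem tensorOn_le {s : Set L} {J : Submodule ℂ (A ⊗[ℂ] B)}
    (h : ∀ i ∈ s, ∀ a ∈ 𝒜 i, ∀ b : B, a ⊗ₜ b ∈ J) : tensorOn 𝒜 B s ≤ J :=
  Submodule.span_le.2 fun _ ⟨i, hi, a, ha, b, ht⟩ => ht ▸ h i hi a ha b

theorem tensorOn_mono {s t : Set L} (h : s ⊆ t) : tensorOn 𝒜 B s ≤ tensorOn 𝒜 B t :=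
  tensorOn_le fun _ hi _ ha b => tmul_mem_tensorOn (h hi) ha b

theorem tmul_mem_tensorOn_of_mem_sumOn {s : Set L} {a : A} (ha : a ∈ sumOn 𝒜 s) (b : B) :
    a ⊗ₜ b ∈ tensorOn 𝒜 B s := by
  have h : sumOn 𝒜 s ≤ (tensorOn 𝒜 B s).comap ((TensorProduct.mk ℂ A B).flip b) :=
    sumOn_le fun i hi a ha => tmul_mem_tensorOn hi ha b
  exact h ha

theorem star_mem_tensorOn {s : Set L} {x : A ⊗[ℂ] B} (hx : x ∈ tensorOn 𝒜 B s) :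
    star x ∈ tensorOn 𝒜 B s := by
  have h : tensorOn 𝒜 B s ≤ (tensorOn 𝒜 B s).comap
      ((starLinearEquiv ℂ : A ⊗[ℂ] B ≃ₗ⋆[ℂ] A ⊗[ℂ] B) : A ⊗[ℂ] B →ₗ⋆[ℂ] A ⊗[ℂ] B) :=
    tensorOn_le fun i hi a ha b => tmul_mem_tensorOn hi (star_mem ha) (star b)
  exact h hx

theorem tensorOn_insert_le [∀ i, IsClosed (𝒜 i : Set A)] (m : L) (s : Set L) :
    tensorOn 𝒜 B (insert m s) ≤
        LinearMap.range (tensorMapLeft B (componentHom 𝒜 m)) ⊔ tensorOn 𝒜 B s := by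
  refine tensorOn_le fun i hi a ha b => ?_
  rcases hi with rfl | hi
  · exact Submodule.mem_sup_left ⟨(⟨a, ha⟩ : 𝒜 i) ⊗ₜ b, rfl⟩
  · exact Submodule.mem_sup_right (tmul_mem_tensorOn hi ha b)

variable [SemilatticeInf L]

theorem mul_mem_tensorOn (h𝒜 : IsSemilatticeGrading 𝒜) {s t r : Set L}
    (h : ∀ i ∈ s, ∀ j ∈ t, i ⊓ j ∈ r) {x y : A ⊗[ℂ] B} (hx : x ∈ tensorOn 𝒜 B s)
    (hy : y ∈ tensorOn 𝒜 B t) : x * y ∈ tensorOn 𝒜 B r := by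
  have h1 : ∀ i ∈ s, ∀ a ∈ 𝒜 i, ∀ b : B, a ⊗ₜ b * y ∈ tensorOn 𝒜 B r := fun i hi a ha b => by
    have : tensorOn 𝒜 B t ≤ (tensorOn 𝒜 B r).comap (LinearMap.mulLeft ℂ (a ⊗ₜ b)) :=
      tensorOn_le fun j hj a' ha' b' => by
        rw [Submodule.mem_comap, LinearMap.mulLeft_apply, Algebra.TensorProduct.tmul_mul_tmul]
        exact tmul_mem_tensorOn (h i hi j hj) (h𝒜.mul_mem i j a ha a' ha') (b * b')
    exact this hy
  have : tensorOn 𝒜 B s ≤ (tensorOn 𝒜 B r).comap (LinearMap.mulRight ℂ y) := tensorOn_le h1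
  exact this hx

theorem exists_finset_mem_tensorOn {t : A ⊗[ℂ] B} (ht : t ∈ tensorOn 𝒜 B Set.univ) :
    ∃ F : Finset L, InfClosed (F : Set L) ∧ t ∈ tensorOn 𝒜 B (F : Set L) := by
  classical
  induction ht using Submodule.span_induction with
  | mem x hx =>
    obtain ⟨i, -, a, ha, b, rfl⟩ := hx
    obtain ⟨F, -, h1, h2⟩ := exists_infClosed_finset infClosed_univ
      (G := {i}) (Set.subset_univ _)
    exact ⟨F, h1, tmul_mem_tensorOn (h2 (by simp)) ha b⟩
  | zero => exact ⟨∅, by simp, zero_mem _⟩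
  | add x y _ _ hx hy =>
    obtain ⟨F, -, h⟩ := hx
    obtain ⟨F', -, h'⟩ := hy
    obtain ⟨G, -, g1, g2⟩ := exists_infClosed_finset infClosed_univ
      (G := F ∪ F') (Set.subset_univ _)
    rw [Finset.coe_union, Set.union_subset_iff] at g2
    exact ⟨G, g1, add_mem (tensorOn_mono g2.1 h) (tensorOn_mono g2.2 h')⟩
  | smul c x _ hx =>
    obtain ⟨F, h1, h2⟩ := hx
    exact ⟨F, h1, Submodule.smul_mem _ c h2⟩

/-- One `t'` serves all C⋆-seminorms because `map_tmul_le` does not depend on `N`. -/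
theorem exists_mem_tensorOn_sub_lt (h𝒜 : IsSemilatticeGrading 𝒜) (t : A ⊗[ℂ] B) {ε : ℝ}
    (hε : 0 < ε) : ∃ t' ∈ tensorOn 𝒜 B Set.univ, ∀ N : Seminorm ℂ (A ⊗[ℂ] B),
      IsCStarSeminorm N → N (t - t') < ε := by
  induction t generalizing ε with
  | zero => exact ⟨0, zero_mem _, fun N _ => by simpa using hε⟩
  | add x y hx hy =>
    obtain ⟨x', hx', h⟩ := hx (half_pos hε)
    obtain ⟨y', hy', h'⟩ := hy (half_pos hε)
    refine ⟨x' + y', add_mem hx' hy', fun N hN => ?_⟩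
    rw [add_sub_add_comm]
    exact (map_add_le_add _ _ _).trans_lt (by linarith [h N hN, h' N hN])
  | tmul a b =>
    -- The summand `1` covers `b = 0`.
    have hr : 0 < ε / (4 * ‖b‖ + 1) := by positivity
    obtain ⟨a', ha', h⟩ := Metric.dense_iff.1 h𝒜.total a _ hr
    have hmem : a' ∈ sumOn 𝒜 Set.univ := by simpa [sumOn] using h
    refine ⟨a' ⊗ₜ b, tmul_mem_tensorOn_of_mem_sumOn hmem b, fun N hN => ?_⟩
    rw [← TensorProduct.sub_tmul]
    rw [Metric.mem_ball, dist_comm, dist_eq_norm, lt_div_iff₀ (by positivity)] at ha'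
    refine (hN.map_tmul_le _ _).trans_lt ?_
    nlinarith [norm_nonneg (a - a')]

variable [∀ i, IsClosed (𝒜 i : Set A)]

/-- The projection onto a component along components that are not above it does not increase the
minimal norm. -/
theorem minNorm_le_minNorm_add (h𝒜 : IsSemilatticeGrading 𝒜) {m : L} {s : Set L}
    (hs : ∀ i ∈ s, ¬ m ≤ i) (k : 𝒜 m ⊗[ℂ] B) {j : A ⊗[ℂ] B} (hj : j ∈ tensorOn 𝒜 B s) :
    minNorm k ≤ minNorm (tensorMapLeft B (componentHom 𝒜 m) k + j) := by
  obtain ⟨θ, hθ, hmul, hzero⟩ := exists_componentAction h𝒜 m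
  refine minNorm_le_iff.2 fun H _ _ _ K _ _ _ π ρ => ?_
  -- The extension of `π` to `A` restricts to `π` on the component and kills the components in `s`,
  -- so `(π ⊗ ρ) k` is also the image of `k + j`.
  have hπ : (extendRep hθ π).comp (componentHom 𝒜 m) = π :=
    NonUnitalStarAlgHom.ext fun c => extendRep_eq hθ π (hmul c)
  have hj0 : tensorOn 𝒜 B s ≤ LinearMap.ker (tensorRep (extendRep hθ π) ρ) :=
    tensorOn_le fun i hi a ha b => by
      rw [LinearMap.mem_ker, tensorRep_tmul, extendRep_eq_zero hθ π (hzero i (hs i hi) a ha)]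
      exact op_ext fun x => by
        rw [opTensor_toHilbertTensor, TensorProduct.mapL_zero_left]
        simp
  have h : tensorRep π ρ k =
      tensorRep (extendRep hθ π) ρ (tensorMapLeft B (componentHom 𝒜 m) k + j) := by
    rw [map_add, LinearMap.mem_ker.1 (hj0 hj), add_zero, ← tensorRep_comp, hπ]
  rw [h]
  exact ofReal_norm_tensorRep_le_minNorm _ _ _

variable {N M : Seminorm ℂ (A ⊗[ℂ] B)}

/-- Induction on `F`, removing a maximal `m`. The rest spans an ideal containing all `hⁿ j`, where
`h = t⋆ t = k + j`, so `le_of_decomposition` applies to `h`; the C⋆-identity returns to `t`. -/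
theorem le_of_mem_tensorOn_finset (h𝒜 : IsSemilatticeGrading 𝒜)
    (hnuc : ∀ i, IsNuclear.{u, v} (𝒜 i)) (hN : IsCStarSeminorm N) (hM : IsCStarSeminorm M)
    (hMmin : ∀ t, ENNReal.ofReal (M t) = minNorm t) (F : Finset L) (hF : InfClosed (F : Set L))
    {t : A ⊗[ℂ] B} (ht : t ∈ tensorOn 𝒜 B (F : Set L)) : N t ≤ M t := by
  classical
  induction hn : F.card generalizing F t with
  | zero =>
    rw [Finset.card_eq_zero] at hn
    have h0 : t = 0 := by simpa [hn, tensorOn] using ht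
    simp [h0]
  | succ n ih =>
    obtain ⟨m, hm⟩ := F.exists_maximal (Finset.card_pos.1 (by omega))
    have hm' : ∀ i ∈ F, ∀ j ∈ F.erase m, i ⊓ j ∈ F.erase m := fun i hi j hj => by
      have hj' := Finset.mem_erase.1 hj
      refine Finset.mem_erase.2 ⟨fun h => hj'.1 ?_, hF hi hj'.2⟩
      exact (hm.eq_of_le hj'.2 (h ▸ inf_le_right)).symm
    have hG : InfClosed (F.erase m : Set L) := fun i hi j hj =>
      hm' i (Finset.mem_of_mem_erase hi) j hj
    have hle : ∀ x ∈ tensorOn 𝒜 B (F.erase m : Set L), N x ≤ M x := fun x hx =>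
      ih (F.erase m) hG hx (by rw [Finset.card_erase_of_mem hm.prop, hn]; rfl)
    have hins : (F : Set L) = insert m (F.erase m : Set L) := by
      rw [← Finset.coe_insert, Finset.insert_erase hm.prop]
    have hsq : star t * t ∈ tensorOn 𝒜 B (F : Set L) :=
      mul_mem_tensorOn h𝒜 (fun i hi j hj => hF hi hj) (star_mem_tensorOn ht) ht
    have hpow : ∀ n, powSucc (star t * t) n ∈ tensorOn 𝒜 B (F : Set L) := fun n => by
      induction n with
      | zero => exact hsq
      | succ n ih => exact mul_mem_tensorOn h𝒜 (fun i hi j hj => hF hi hj) ih hsq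
    have hdec := hsq
    rw [hins] at hdec
    obtain ⟨_, ⟨k, rfl⟩, j, hj, hkj⟩ := Submodule.mem_sup.1 (tensorOn_insert_le m _ hdec)
    have hk : N (tensorMapLeft B (componentHom 𝒜 m) k) ≤ M (star t * t) := by
      rw [← ENNReal.ofReal_le_ofReal_iff (apply_nonneg _ _), hMmin, ← hkj]
      refine (isNuclear_iff.1 (hnuc m) B _ (hN.comp_tensorMapLeft (componentHom 𝒜 m)) k).trans ?_
      refine minNorm_le_minNorm_add h𝒜 (fun i hi hmi => ?_) k hj
      have hi' := Finset.mem_erase.1 hi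
      exact hi'.1 (hm.eq_of_le hi'.2 hmi).symm
    have key := hN.le_of_decomposition hM (IsSelfAdjoint.star_mul_self t) hkj.symm hk fun n =>
      hle _ (mul_mem_tensorOn h𝒜 hm' (hpow n) hj)
    rw [hN.star_mul_self, hM.star_mul_self] at key
    exact (sq_le_sq₀ (apply_nonneg _ _) (apply_nonneg _ _)).1 key

theorem isNuclear_of_components (h𝒜 : IsSemilatticeGrading 𝒜)
    (hnuc : ∀ i, IsNuclear.{u, v} (𝒜 i)) : IsNuclear.{u, v} A := by
  refine isNuclear_iff.2 fun B _ N hN t => ?_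
  obtain ⟨M, hM, hMmin⟩ := exists_isCStarSeminorm_eq_minNorm A B
  rw [← hMmin]
  refine ENNReal.ofReal_le_ofReal (le_of_forall_pos_le_add fun ε hε => ?_)
  obtain ⟨t', ht', h⟩ := exists_mem_tensorOn_sub_lt h𝒜 t (half_pos hε)
  obtain ⟨F, hF, htF⟩ := exists_finset_mem_tensorOn ht'
  have h1 := le_of_mem_tensorOn_finset h𝒜 hnuc hN hM hMmin F hF htF
  have h2 : N t ≤ N (t - t') + N t' := by simpa using map_add_le_add N (t - t') t'
  have h3 : M t' ≤ M (t - t') + M t := by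
    have := map_add_le_add M (t' - t) t
    rwa [sub_add_cancel, map_sub_rev] at this
  linarith [h N hN, h M hM]

end NuclearSum

end GradedCStar

end

theorem proposition5p2p1 {L : Type w} [SemilatticeInf L]
    {A : Type u} [NonUnitalCStarAlgebra A]
    (𝒜 : L → NonUnitalStarSubalgebra ℂ A) [∀ i, IsClosed (𝒜 i : Set A)]
    (h𝒜 : GradedCStar.IsSemilatticeGrading 𝒜) :
    GradedCStar.IsNuclear.{u, v} A ↔ ∀ i, GradedCStar.IsNuclear.{u, v} (𝒜 i) :=
  ⟨GradedCStar.isNuclear_component h𝒜, GradedCStar.isNuclear_of_components h𝒜⟩
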